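/- Let $N\ge 1$, let $\Omega\subset\mathbb R^N$ be a bounded domain, and let $V=H^1_0(\Omega)$ (the closure of $C_c^\infty(\Omega)$ in $H^1(\Omega)$) with norm $\|v\|_V=\|\nabla v\|_{L^2(\Omega)}$. Put $p^*=\infty$ if $N\le 2$ and $p^*=\frac{N+2}{N-2}$ if $N\ge 3$. Let $f:\mathbb R\to\mathbb R$ be a $C^1$ function for which there are $a_0,b_0,a_1,b_1\ge 0$ and $p<p^*$ with $|f(t)|\le a_0|t|^p+b_0$ and $|f'(t)|\le a_1|t|^{p-1}+b_1$ for all $t\in\mathbb R$. Let $\hat u\in V\cap L^\infty(\Omega)$, $\rho>0$, $r>0$, and let $u\in V$ be a weak solution of $-\Delta u=f(u)$, that is, $$\int_\Omega\nabla u\cdot\nabla v\,dx=\int_\Omega f(u)\,v\,dx\quad\text{for all }v\in V,$$ which satisfies $$\|u-\hat u\|_V\le\rho\qquad\text{and}\qquad\|u-\hat u\|_{L^\infty(\Omega)}\le r .$$ Let $\Omega_0$ be the interior of $\Omega\setminus\{x\in\Omega:\hat u(x)-r>0\}$, where, since $\hat u$ is defined only almost everywhere, this means the open set of all points of $\Omega$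 having a neighbourhood in which $\{\hat u-r>0\}$ has measure zero (for continuous $\hat u$ this is the ordinary interior). Let $\lambda_1(\Omega_0)$ be the smallest number $\mu$ for which there is $0\ne v\in H^1_0(\Omega_0)$ with $\int_{\Omega_0}\nabla v\cdot\nabla w\,dx=\mu\int_{\Omega_0}vw\,dx$ for all $w\in H^1_0(\Omega_0)$, with $\lambda_1(\emptyset)=+\infty$ (and $c/\infty=0$). Suppose that $$-f(-t)\le\lambda t+\sum_{i=1}^n a_i t^{p_i}\quad\text{for all }t\ge 0$$ for some real $\lambda<\lambda_1(\Omega_0)$, coefficients $a_1,\dots,a_n\ge 0$ and exponents $p_1,\dots,p_n\in(1,p^*)$. For each $i$ let $C_{p_i+1}>0$ be a number with $\|v\|_{L^{p_i+1}(\Omega)}\le C_{p_i+1}\|v\|_V$ for all $v\in V$, and write $\hat u_-=\max\{-\hat u,0\}$. If $$\sum_{i=1}^n a_i\,C_{p_i+1}^2\left(\|\hat u_-\|_{L^{p_i+1}(\Omega)}+C_{p_i+1}\,\rho\right)^{p_i-1}<1-\frac{\max\{\lambda,0\}}{\lambda_1(\Omega_0)},$$ then $u\ge 0$ almost everywhere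 in $\Omega$. -/

import Mathlib

open MeasureTheory Set Filter Topology
open scoped ENNReal ContDiff RealInnerProductSpace

noncomputable section

namespace EllipticPositivity

/-- Test functions on `U`: smooth functions with compact support contained in `U`. -/
structure IsTestFunction {N : ℕ} (U : Set (EuclideanSpace ℝ (Fin N)))
    (φ : EuclideanSpace ℝ (Fin N) → ℝ) : Prop where
  smooth : ContDiff ℝ ∞ φ
  compact : HasCompactSupport φ
  support : tsupport φ ⊆ U

/-- `u` belongs to the Sobolev space `H¹(U)` and `g` is its weak gradient. Only the values
on `U` matter, and these only up to null sets. -/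
structure MemH1 {N : ℕ} (U : Set (EuclideanSpace ℝ (Fin N)))
    (u : EuclideanSpace ℝ (Fin N) → ℝ)
    (g : EuclideanSpace ℝ (Fin N) → EuclideanSpace ℝ (Fin N)) : Prop where
  memLp_fun : MemLp u 2 (volume.restrict U)
  memLp_grad : MemLp g 2 (volume.restrict U)
  weak_grad : ∀ φ, IsTestFunction U φ →
    ∫ x in U, u x • gradient φ x = - ∫ x in U, φ x • g x

/-- `u` belongs to `H¹₀(U)`, the closure of the test functions in `H¹(U)`, and `g` is its weak
gradient. -/
structure MemH10 {N : ℕ} (U : Set (EuclideanSpace ℝ (Fin N)))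
    (u : EuclideanSpace ℝ (Fin N) → ℝ)
    (g : EuclideanSpace ℝ (Fin N) → EuclideanSpace ℝ (Fin N)) : Prop extends MemH1 U u g where
  approx : ∀ ε : ℝ≥0∞, 0 < ε → ∃ φ, IsTestFunction U φ ∧
    eLpNorm (fun x => u x - φ x) 2 (volume.restrict U) ≤ ε ∧
    eLpNorm (fun x => g x - gradient φ x) 2 (volume.restrict U) ≤ ε

/-- `μ` is an eigenvalue of `-Δ` on `U` with homogeneous Dirichlet boundary condition, in the
weak sense. -/
def IsDirichletEigenvalue {N : ℕ} (U : Set (EuclideanSpace ℝ (Fin N))) (μ : ℝ) : Prop :=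
  ∃ v g, MemH10 U v g ∧ ¬ (∀ᵐ x ∂(volume.restrict U), v x = 0) ∧
    ∀ w h, MemH10 U w h →
      ∫ x in U, ⟪g x, h x⟫ = μ * ∫ x in U, v x * w x

/-- The first Dirichlet eigenvalue `λ₁(U)` of `-Δ`; it is `+∞` if there is no eigenvalue,
in particular for the empty set. -/
def firstDirichletEigenvalue {N : ℕ} (U : Set (EuclideanSpace ℝ (Fin N))) : EReal :=
  sInf ((fun μ : ℝ => (μ : EReal)) '' {μ | IsDirichletEigenvalue U μ})

/-- `p < p*`, where `p* = ∞` for `N = 1, 2` and `p* = (N + 2) / (N - 2)` for `N ≥ 3`. -/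
def Subcritical (N : ℕ) (p : ℝ) : Prop :=
  3 ≤ N → p < ((N : ℝ) + 2) / ((N : ℝ) - 2)

/-- The standing assumption on the nonlinearity: it is `C¹`, and it and its derivative have
subcritical growth. -/
def AdmissibleNonlinearity (N : ℕ) (f : ℝ → ℝ) : Prop :=
  ContDiff ℝ 1 f ∧
    ∃ p a₀ b₀ a₁ b₁ : ℝ, Subcritical N p ∧ 0 ≤ a₀ ∧ 0 ≤ b₀ ∧ 0 ≤ a₁ ∧ 0 ≤ b₁ ∧
      (∀ t, |f t| ≤ a₀ * |t| ^ p + b₀) ∧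
      (∀ t, |deriv f t| ≤ a₁ * |t| ^ (p - 1) + b₁)

/-- `u`, with weak gradient `g`, is a weak solution in `H¹₀(Ω)` of `-Δu = f(u)`. -/
def IsWeakSolution {N : ℕ} (Ω : Set (EuclideanSpace ℝ (Fin N))) (f : ℝ → ℝ)
    (u : EuclideanSpace ℝ (Fin N) → ℝ)
    (g : EuclideanSpace ℝ (Fin N) → EuclideanSpace ℝ (Fin N)) : Prop :=
  MemH10 Ω u g ∧ ∀ v h, MemH10 Ω v h →
    (∫ x in Ω, ⟪g x, h x⟫) - ∫ x in Ω, f (u x) * v x = 0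

/-- `C` is a norm bound for the embedding of `H¹₀(Ω)`, with norm `‖∇·‖_{L²}`, into `L^q(Ω)`. -/
def IsEmbeddingBound {N : ℕ} (Ω : Set (EuclideanSpace ℝ (Fin N))) (q C : ℝ) : Prop :=
  0 < C ∧ ∀ v g, MemH10 Ω v g →
    eLpNorm v (ENNReal.ofReal q) (volume.restrict Ω) ≤
      ENNReal.ofReal C * eLpNorm g 2 (volume.restrict Ω)

/-- The interior of `Ω \ {x ∈ Ω | û x - r > 0}` for an almost everywhere defined function `û`:
the points of `Ω` with a neighbourhood in which `{û - r > 0}` is a null set. It does not depend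
on the representative of `û`; for continuous `û` it is the pointwise interior
(`possiblyNegativeRegion_eq_interior`). -/
def possiblyNegativeRegion {N : ℕ} (Ω : Set (EuclideanSpace ℝ (Fin N)))
    (uhat : EuclideanSpace ℝ (Fin N) → ℝ) (r : ℝ) : Set (EuclideanSpace ℝ (Fin N)) :=
  {x | x ∈ Ω ∧ ∃ W ∈ 𝓝 x, volume (W ∩ {y | y ∈ Ω ∧ uhat y - r > 0}) = 0}

theorem possiblyNegativeRegion_eq_interior {N : ℕ} {Ω : Set (EuclideanSpace ℝ (Fin N))}
    (hΩ : IsOpen Ω) {uhat : EuclideanSpace ℝ (Fin N) → ℝ} (hu : ContinuousOn uhat Ω) (r : ℝ) :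
    possiblyNegativeRegion Ω uhat r = interior (Ω \ {y | y ∈ Ω ∧ uhat y - r > 0}) := by
  have hS : IsOpen {y | y ∈ Ω ∧ uhat y - r > 0} :=
    (hu.sub continuousOn_const).isOpen_inter_preimage hΩ isOpen_Ioi
  ext x
  rw [mem_interior_iff_mem_nhds]
  constructor
  · rintro ⟨hx, W, hW, h0⟩
    have hI : IsOpen (interior W ∩ {y | y ∈ Ω ∧ uhat y - r > 0}) := isOpen_interior.inter hS
    have he := hI.eq_empty_of_measure_zero
      (measure_mono_null (inter_subset_inter_left _ interior_subset) h0)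
    filter_upwards [interior_mem_nhds.2 hW, hΩ.mem_nhds hx] with y hy hyΩ
    exact ⟨hyΩ, fun hyS => (he ▸ (⟨hy, hyS⟩ : y ∈ interior W ∩ _) : y ∈ (∅ : Set _))⟩
  · intro h
    exact ⟨(mem_of_mem_nhds h).1, _, h, by rw [sdiff_inter_self, measure_empty]⟩

end EllipticPositivity

end

/-! Since `û` and `u - û` are bounded, so are `u` and `f(u)`, and interior regularity gives `u` a
representative `w` that is continuous on `Ω`. The set `{w < 0}` is open and `û ≤ r` holds almost
everywhere on it, so it lies in `Ω₀`. Hence the negative part `v = max(-w, 0)` belongs to `H¹₀(Ω₀)`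
as well as to `H¹₀(Ω)`. With `D = ∫ |∇v|²` and `S = ∫ v²`, testing the equation with `v` gives `D =
∫ -f(-v) v ≤ λ S + ∑ aᵢ ∫ v^(pᵢ+1)`. Write `∫ v^(pᵢ+1) = ‖v‖^(pᵢ-1) ‖v‖²` in the norm of `L^(pᵢ+1)`:
the square is at most `Cᵢ² D`, and `v ≤ û₋ + |w - û|` bounds the other factor by `(‖û₋‖ + Cᵢ
ρ)^(pᵢ-1)`. So `D ≤ λ S + σ D`, where `σ` is the left side of the smallness condition. Together with
`λ₁(Ω₀) S ≤ D` this is impossible for `v ≠ 0` (`false_of_energy_le`).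

Three analytic facts carry the argument.

Continuity (`MemH10.exists_continuousOn_ae_eq`): average `u` around `x` at scale `s` with a radial
kernel `k` such that `-k(y) y` is the gradient of a bump. The derivative in `s` is then a pairing of
`∇u` with the gradient of a test function, which the equation bounds by a multiple of `s`. The
averages therefore converge locally uniformly as `s → 0`, and at Lebesgue points they converge to a
constant times `u`.

Localization (`MemH10.negPart_of_continuousOn`): no boundary regularity is available. Let `φₙ` be
test functions of `Ω` tending to `w`. A truncated negative part of `w`, multiplied by a cutoff of
`φₙ`, lives on a compact subset of `{w < 0}`; letting `n → ∞` and then removing the truncation gives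
the claim.

Spectral bound (`exists_firstDirichletEigenvalue_eq`): `λ₁` is an infimum over eigenvalues, so the
Rayleigh inequality requires an eigenvalue that attains the minimal quotient. It comes from Rellich
compactness and `exists_minimal_rayleigh`. -/

noncomputable section

namespace EllipticPositivity

/-! ### Convergence in `L²` -/

/-- Dominated convergence to zero in `L²`. -/
theorem tendsto_eLpNorm_two_zero_of_dominated {α F : Type*} {m : MeasurableSpace α}
    {μ : Measure α} [NormedAddCommGroup F] {f : ℕ → α → F} {b : α → ℝ}
    (hf : ∀ n, AEStronglyMeasurable (f n) μ) (hb : MemLp b 2 μ)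
    (hbound : ∀ n, ∀ᵐ x ∂μ, ‖f n x‖ ≤ b x)
    (hlim : ∀ᵐ x ∂μ, Tendsto (fun n => f n x) atTop (𝓝 0)) :
    Tendsto (fun n => eLpNorm (f n) 2 μ) atTop (𝓝 0) := by
  have key : Tendsto (fun n => ∫⁻ x, ‖f n x‖ₑ ^ (2 : ℝ) ∂μ) atTop (𝓝 (∫⁻ _, 0 ∂μ)) := by
    refine tendsto_lintegral_of_dominated_convergence' (fun x => ‖b x‖ₑ ^ (2 : ℝ))
      (fun n => (hf n).enorm.pow_const _) (fun n => ?_) ?_ ?_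
    · filter_upwards [hbound n] with x hx
      gcongr
      rw [enorm_le_iff_norm_le, Real.norm_eq_abs]
      exact hx.trans (le_abs_self _)
    · have := (lintegral_rpow_enorm_lt_top_of_eLpNorm_lt_top two_ne_zero ENNReal.ofNat_ne_top hb.2).ne
      simpa using this
    · filter_upwards [hlim] with x hx
      have h1 : Tendsto (fun n => ‖f n x‖ₑ) atTop (𝓝 0) := by
        simpa using hx.enorm
      have h2 := (ENNReal.continuous_rpow_const (y := (2 : ℝ))).tendsto (0 : ℝ≥0∞)
      simpa [Function.comp_def] using h2.comp h1
  have h2 := ((ENNReal.continuous_rpow_const (y := (1 / 2 : ℝ))).tendsto _).comp key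
  simp only [lintegral_zero] at h2
  rw [ENNReal.zero_rpow_of_pos (by norm_num)] at h2
  refine h2.congr fun n => ?_
  rw [eLpNorm_eq_lintegral_rpow_enorm_toReal two_ne_zero ENNReal.ofNat_ne_top]
  simp

theorem memLp_two_of_tendsto_eLpNorm {α F : Type*} {m : MeasurableSpace α}
    {μ : Measure α} [NormedAddCommGroup F] {f : ℕ → α → F} {g : α → F}
    (hf : ∀ n, MemLp (f n) 2 μ) (hg : AEStronglyMeasurable g μ)
    (h : Tendsto (fun n => eLpNorm (fun x => g x - f n x) 2 μ) atTop (𝓝 0)) : MemLp g 2 μ := by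
  obtain ⟨n, hn⟩ := (h.eventually (gt_mem_nhds (zero_lt_one))).exists
  have h1 : MemLp (fun x => g x - f n x) 2 μ := ⟨hg.sub (hf n).1, hn.trans ENNReal.one_lt_top⟩
  have h2 := h1.add (hf n)
  have e : (fun x => g x - f n x) + f n = g := by ext x; simp
  rwa [e] at h2

/-! ### Gradients and test functions -/

variable {N : ℕ} {U Ω : Set (EuclideanSpace ℝ (Fin N))}

section gradient

variable {φ ψ : EuclideanSpace ℝ (Fin N) → ℝ} {x : EuclideanSpace ℝ (Fin N)}

theorem gradient_comp_eq {G : ℝ → ℝ} (hG : DifferentiableAt ℝ G (φ x))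
    (hφ : DifferentiableAt ℝ φ x) :
    gradient (fun y => G (φ y)) x = deriv G (φ x) • gradient φ x := by
  refine HasGradientAt.gradient ?_
  have h := hG.hasDerivAt.comp_hasFDerivAt x hφ.hasFDerivAt
  rw [hasGradientAt_iff_hasFDerivAt, map_smul, toDual_gradient]
  exact h

theorem gradient_mul_eq (hφ : DifferentiableAt ℝ φ x) (hψ : DifferentiableAt ℝ ψ x) :
    gradient (fun y => φ y * ψ y) x = φ x • gradient ψ x + ψ x • gradient φ x := by
  refine HasGradientAt.gradient ?_
  have h := hφ.hasFDerivAt.mul hψ.hasFDerivAt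
  rw [hasGradientAt_iff_hasFDerivAt, map_add, map_smul, map_smul, toDual_gradient, toDual_gradient]
  exact h

theorem gradient_add_eq (hφ : DifferentiableAt ℝ φ x) (hψ : DifferentiableAt ℝ ψ x) :
    gradient (fun y => φ y + ψ y) x = gradient φ x + gradient ψ x := by
  refine HasGradientAt.gradient ?_
  have h := hφ.hasFDerivAt.add hψ.hasFDerivAt
  rw [hasGradientAt_iff_hasFDerivAt, map_add, toDual_gradient, toDual_gradient]
  exact h

theorem gradient_const_mul_eq (c : ℝ) (hφ : DifferentiableAt ℝ φ x) :
    gradient (fun y => c * φ y) x = c • gradient φ x := by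
  refine HasGradientAt.gradient ?_
  have h := hφ.hasFDerivAt.const_mul c
  rw [hasGradientAt_iff_hasFDerivAt, map_smul, toDual_gradient]
  exact h

end gradient

namespace IsTestFunction

variable {φ ψ : EuclideanSpace ℝ (Fin N) → ℝ}

theorem differentiable (hφ : IsTestFunction U φ) : Differentiable ℝ φ :=
  hφ.smooth.differentiable (by simp)

theorem continuous (hφ : IsTestFunction U φ) : Continuous φ := hφ.smooth.continuous

theorem mono (hφ : IsTestFunction U φ) (h : U ⊆ Ω) : IsTestFunction Ω φ :=
  ⟨hφ.smooth, hφ.compact, hφ.support.trans h⟩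

theorem eq_zero (hφ : IsTestFunction U φ) {x : EuclideanSpace ℝ (Fin N)} (hx : x ∉ U) :
    φ x = 0 := image_eq_zero_of_notMem_tsupport fun h => hx (hφ.support h)

theorem contDiff_gradient {φ : EuclideanSpace ℝ (Fin N) → ℝ} (hφ : ContDiff ℝ ∞ φ) :
    ContDiff ℝ ∞ (gradient φ) := by
  have h : ContDiff ℝ ∞ (fderiv ℝ φ) := hφ.fderiv_right (by simp)
  exact (InnerProductSpace.toDual ℝ (EuclideanSpace ℝ (Fin N))).symm.contDiff.comp h

theorem continuous_gradient (hφ : IsTestFunction U φ) : Continuous (gradient φ) :=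
  (contDiff_gradient hφ.smooth).continuous

theorem gradient_eq_zero_of_notMem_tsupport {φ : EuclideanSpace ℝ (Fin N) → ℝ}
    {x : EuclideanSpace ℝ (Fin N)} (hx : x ∉ tsupport φ) : gradient φ x = 0 := by
  have h : φ =ᶠ[𝓝 x] fun _ => 0 := notMem_tsupport_iff_eventuallyEq.1 hx
  rw [h.gradient_eq]
  exact gradient_fun_const x 0

theorem hasCompactSupport_gradient (hφ : IsTestFunction U φ) : HasCompactSupport (gradient φ) :=
  hφ.compact.mono' fun x hx => by
    by_contra h
    exact hx (gradient_eq_zero_of_notMem_tsupport h)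

theorem gradient_eq_zero (hφ : IsTestFunction U φ) {x : EuclideanSpace ℝ (Fin N)} (hx : x ∉ U) :
    gradient φ x = 0 := gradient_eq_zero_of_notMem_tsupport fun h => hx (hφ.support h)

theorem memLp (hφ : IsTestFunction U φ) (q : ℝ≥0∞) (V : Set (EuclideanSpace ℝ (Fin N))) :
    MemLp φ q (volume.restrict V) :=
  (hφ.continuous.memLp_of_hasCompactSupport hφ.compact (p := q) (μ := volume)).restrict V

theorem memLp_gradient (hφ : IsTestFunction U φ) (q : ℝ≥0∞)
    (V : Set (EuclideanSpace ℝ (Fin N))) : MemLp (gradient φ) q (volume.restrict V) :=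
  (hφ.continuous_gradient.memLp_of_hasCompactSupport hφ.hasCompactSupport_gradient
    (p := q) (μ := volume)).restrict V

theorem comp (hφ : IsTestFunction U φ) {G : ℝ → ℝ} (hG : ContDiff ℝ ∞ G) (h0 : G 0 = 0) :
    IsTestFunction U (fun x => G (φ x)) :=
  ⟨hG.comp hφ.smooth, hφ.compact.comp_left h0,
    (tsupport_comp_subset h0 φ).trans hφ.support⟩

theorem mul (hφ : IsTestFunction U φ) (hψ : ContDiff ℝ ∞ ψ) :
    IsTestFunction U (fun x => φ x * ψ x) :=
  ⟨hφ.smooth.mul hψ, hφ.compact.mul_right, (tsupport_mul_subset_left).trans hφ.support⟩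

theorem add (hφ : IsTestFunction U φ) (hψ : IsTestFunction U ψ) :
    IsTestFunction U (fun x => φ x + ψ x) :=
  ⟨hφ.smooth.add hψ.smooth, hφ.compact.add hψ.compact,
    (tsupport_add φ ψ).trans (union_subset hφ.support hψ.support)⟩

theorem const_mul (c : ℝ) (hφ : IsTestFunction U φ) : IsTestFunction U (fun x => c * φ x) :=
  hφ.comp (G := fun t => c * t) (by fun_prop) (by simp)

theorem zero : IsTestFunction U (fun _ => (0 : ℝ)) := by
  refine ⟨contDiff_const, HasCompactSupport.zero, ?_⟩
  have : tsupport (fun _ : EuclideanSpace ℝ (Fin N) => (0 : ℝ)) = ∅ := tsupport_eq_empty_iff.2 rfl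
  simp [this]

theorem exists_bound (hφ : IsTestFunction U φ) : ∃ B, 0 ≤ B ∧ ∀ x, |φ x| ≤ B := by
  obtain ⟨B, hB⟩ := hφ.continuous.bounded_above_of_compact_support hφ.compact
  exact ⟨B, (norm_nonneg _).trans (hB 0), hB⟩

theorem exists_bound_gradient (hφ : IsTestFunction U φ) :
    ∃ B, 0 ≤ B ∧ ∀ x, ‖gradient φ x‖ ≤ B := by
  obtain ⟨B, hB⟩ :=
    hφ.continuous_gradient.bounded_above_of_compact_support hφ.hasCompactSupport_gradient
  exact ⟨B, (norm_nonneg _).trans (hB 0), hB⟩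

theorem setIntegral_eq {F : Type*} [NormedAddCommGroup F] [NormedSpace ℝ F]
    {w : EuclideanSpace ℝ (Fin N) → F} (h : ∀ x ∉ U, w x = 0) :
    ∫ x in U, w x = ∫ x, w x := setIntegral_eq_integral_of_forall_compl_eq_zero h

/-- Pairing with a fixed vector `e` reduces this to scalar integration by parts in direction `e`.
Both integrands vanish off `U`, so the integrals may be taken over the whole space, with no boundary
term. -/
theorem integral_smul_gradient (hφ : IsTestFunction U φ) (hψ : IsTestFunction U ψ) :
    ∫ x in U, φ x • gradient ψ x = - ∫ x in U, ψ x • gradient φ x := by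
  rw [setIntegral_eq fun x hx => by rw [hφ.eq_zero hx, zero_smul],
    setIntegral_eq fun x hx => by rw [hψ.eq_zero hx, zero_smul]]
  have i1 : Integrable (fun x => φ x • gradient ψ x) :=
    (hφ.continuous.smul hψ.continuous_gradient).integrable_of_hasCompactSupport
      (hφ.compact.smul_right)
  have i2 : Integrable (fun x => ψ x • gradient φ x) :=
    (hψ.continuous.smul hφ.continuous_gradient).integrable_of_hasCompactSupport
      (hψ.compact.smul_right)
  refine ext_inner_left ℝ fun e => ?_
  rw [inner_neg_right, ← integral_inner i1, ← integral_inner i2]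
  have e1 : ∀ x, ⟪e, φ x • gradient ψ x⟫ = φ x * fderiv ℝ ψ x e := fun x => by
    rw [inner_smul_right, inner_gradient_right]; simp
  have e2 : ∀ x, ⟪e, ψ x • gradient φ x⟫ = fderiv ℝ φ x e * ψ x := fun x => by
    rw [inner_smul_right, inner_gradient_right]; simp [mul_comm]
  simp only [e1, e2]
  refine integral_mul_fderiv_eq_neg_fderiv_mul_of_integrable ?_ ?_ ?_
    (fun x _ => hφ.differentiable x) (fun x _ => hψ.differentiable x)
  · simpa only [e2] using i2.const_inner (𝕜 := ℝ) e
  · simpa only [e1] using i1.const_inner (𝕜 := ℝ) e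
  · exact (hφ.continuous.mul hψ.continuous).integrable_of_hasCompactSupport hφ.compact.mul_right

end IsTestFunction

/-! ### `H¹₀` as a closed linear space -/

/-- A sequence of test functions approximating in `H¹` yields the weak gradient. -/
theorem memH10_of_tendsto_test {u : EuclideanSpace ℝ (Fin N) → ℝ}
    {g : EuclideanSpace ℝ (Fin N) → EuclideanSpace ℝ (Fin N)}
    {φ : ℕ → EuclideanSpace ℝ (Fin N) → ℝ} (hφ : ∀ n, IsTestFunction U (φ n))
    (hu : AEStronglyMeasurable u (volume.restrict U))
    (hg : AEStronglyMeasurable g (volume.restrict U))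
    (h1 : Tendsto (fun n => eLpNorm (fun x => u x - φ n x) 2 (volume.restrict U)) atTop (𝓝 0))
    (h2 : Tendsto (fun n => eLpNorm (fun x => g x - gradient (φ n) x) 2 (volume.restrict U))
      atTop (𝓝 0)) : MemH10 U u g := by
  have mu : MemLp u 2 (volume.restrict U) :=
    memLp_two_of_tendsto_eLpNorm (fun n => (hφ n).memLp 2 U) hu h1
  have mg : MemLp g 2 (volume.restrict U) :=
    memLp_two_of_tendsto_eLpNorm (fun n => (hφ n).memLp_gradient 2 U) hg h2
  refine ⟨⟨mu, mg, fun ψ hψ => ?_⟩, fun ε hε => ?_⟩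
  -- Both sides of the integration by parts formula for `φ n` converge: by Hölder, `L²` convergence
  -- against a fixed `L²` factor gives `L¹` convergence of the products.
  · have t1 : Tendsto (fun n => ∫ x in U, φ n x • gradient ψ x) atTop
        (𝓝 (∫ x in U, u x • gradient ψ x)) := by
      refine tendsto_integral_of_L1' _ ?_ (Eventually.of_forall fun n => ?_) ?_
      · exact (memLp_one_iff_integrable.1 ((hψ.memLp_gradient 2 U).smul mu)).1
      · exact memLp_one_iff_integrable.1 ((hψ.memLp_gradient 2 U).smul ((hφ n).memLp 2 U))
      · have hb : Tendsto (fun n => eLpNorm (fun x => u x - φ n x) 2 (volume.restrict U) *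
            eLpNorm (gradient ψ) 2 (volume.restrict U)) atTop (𝓝 0) := by
          simpa using ENNReal.Tendsto.mul_const h1 (Or.inr (hψ.memLp_gradient 2 U).2.ne)
        refine tendsto_of_tendsto_of_tendsto_of_le_of_le tendsto_const_nhds hb
          (fun _ => zero_le) fun n => ?_
        have := eLpNorm_smul_le_mul_eLpNorm (p := 2) (q := 2) (r := 1)
          (hψ.memLp_gradient 2 U).1 (mu.sub ((hφ n).memLp 2 U)).1
        refine le_trans (le_of_eq ?_) this
        rw [eLpNorm_sub_comm]
        congr 1
        ext x
        simp [sub_smul]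
    have t2 : Tendsto (fun n => ∫ x in U, ψ x • gradient (φ n) x) atTop
        (𝓝 (∫ x in U, ψ x • g x)) := by
      refine tendsto_integral_of_L1' _ ?_ (Eventually.of_forall fun n => ?_) ?_
      · exact (memLp_one_iff_integrable.1 (mg.smul (hψ.memLp 2 U))).1
      · exact memLp_one_iff_integrable.1 (((hφ n).memLp_gradient 2 U).smul (hψ.memLp 2 U))
      · have hb : Tendsto (fun n => eLpNorm ψ 2 (volume.restrict U) *
            eLpNorm (fun x => g x - gradient (φ n) x) 2 (volume.restrict U)) atTop (𝓝 0) := by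
          simpa using ENNReal.Tendsto.const_mul h2 (Or.inr (hψ.memLp 2 U).2.ne)
        refine tendsto_of_tendsto_of_tendsto_of_le_of_le tendsto_const_nhds hb
          (fun _ => zero_le) fun n => ?_
        have := eLpNorm_smul_le_mul_eLpNorm (p := 2) (q := 2) (r := 1)
          (mg.sub ((hφ n).memLp_gradient 2 U)).1 (hψ.memLp 2 U).1
        refine le_trans (le_of_eq ?_) this
        rw [eLpNorm_sub_comm]
        congr 1
        ext x
        simp [mul_sub]
    refine tendsto_nhds_unique t1 (t2.neg.congr fun n => ?_)
    rw [(hφ n).integral_smul_gradient hψ]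
  · obtain ⟨n, hn1, hn2⟩ := ((h1.eventually (ge_mem_nhds hε)).and
      (h2.eventually (ge_mem_nhds hε))).exists
    exact ⟨φ n, hφ n, hn1, hn2⟩

namespace MemH10

variable {u v : EuclideanSpace ℝ (Fin N) → ℝ}
  {g h : EuclideanSpace ℝ (Fin N) → EuclideanSpace ℝ (Fin N)}

/-- Test functions approximating an element of `H¹₀(U)` in `H¹` and almost everywhere. -/
theorem exists_seq (hu : MemH10 U u g) : ∃ φ : ℕ → EuclideanSpace ℝ (Fin N) → ℝ,
    (∀ n, IsTestFunction U (φ n)) ∧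
    Tendsto (fun n => eLpNorm (fun x => u x - φ n x) 2 (volume.restrict U)) atTop (𝓝 0) ∧
    Tendsto (fun n => eLpNorm (fun x => g x - gradient (φ n) x) 2 (volume.restrict U))
      atTop (𝓝 0) ∧
    ∀ᵐ x ∂(volume.restrict U), Tendsto (fun n => φ n x) atTop (𝓝 (u x)) := by
  choose φ hφ h1 h2 using fun n : ℕ => hu.approx ((n : ℝ≥0∞) + 1)⁻¹ (by simp)
  have hz : Tendsto (fun n : ℕ => ((n : ℝ≥0∞) + 1)⁻¹) atTop (𝓝 0) := by
    have := (tendsto_add_atTop_iff_nat 1).2 ENNReal.tendsto_inv_nat_nhds_zero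
    simpa using this
  have t1 := tendsto_of_tendsto_of_tendsto_of_le_of_le tendsto_const_nhds hz
    (fun _ => zero_le) h1
  have t2 := tendsto_of_tendsto_of_tendsto_of_le_of_le tendsto_const_nhds hz
    (fun _ => zero_le) h2
  -- `L²` convergence implies convergence in measure, hence almost everywhere convergence along a
  -- subsequence.
  have t3 : TendstoInMeasure (volume.restrict U) φ atTop u := by
    refine tendstoInMeasure_of_tendsto_eLpNorm (p := 2) two_ne_zero
      (fun n => ((hφ n).memLp 2 U).1) hu.memLp_fun.1 ?_
    refine t1.congr fun n => ?_
    exact eLpNorm_sub_comm _ _ _ _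
  obtain ⟨ns, hns, hae⟩ := t3.exists_seq_tendsto_ae
  exact ⟨fun n => φ (ns n), fun n => hφ _, t1.comp hns.tendsto_atTop, t2.comp hns.tendsto_atTop,
    hae⟩

theorem of_isTestFunction {φ : EuclideanSpace ℝ (Fin N) → ℝ} (hφ : IsTestFunction U φ) :
    MemH10 U φ (gradient φ) :=
  memH10_of_tendsto_test (φ := fun _ => φ) (fun _ => hφ) (hφ.memLp 2 U).1
    (hφ.memLp_gradient 2 U).1 (by simp) (by simp)

/-- `H¹₀(U)` is closed under limits in `H¹(U)`. -/
theorem of_tendsto {v : ℕ → EuclideanSpace ℝ (Fin N) → ℝ}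
    {h : ℕ → EuclideanSpace ℝ (Fin N) → EuclideanSpace ℝ (Fin N)}
    (hv : ∀ n, MemH10 U (v n) (h n))
    (hu : AEStronglyMeasurable u (volume.restrict U))
    (hg : AEStronglyMeasurable g (volume.restrict U))
    (h1 : Tendsto (fun n => eLpNorm (fun x => u x - v n x) 2 (volume.restrict U)) atTop (𝓝 0))
    (h2 : Tendsto (fun n => eLpNorm (fun x => g x - h n x) 2 (volume.restrict U))
      atTop (𝓝 0)) : MemH10 U u g := by
  choose φ hφ a1 a2 using fun n : ℕ => (hv n).approx ((n : ℝ≥0∞) + 1)⁻¹ (by simp)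
  have hz : Tendsto (fun n : ℕ => ((n : ℝ≥0∞) + 1)⁻¹) atTop (𝓝 0) := by
    have := (tendsto_add_atTop_iff_nat 1).2 ENNReal.tendsto_inv_nat_nhds_zero
    simpa using this
  refine memH10_of_tendsto_test hφ hu hg ?_ ?_
  · refine tendsto_of_tendsto_of_tendsto_of_le_of_le tendsto_const_nhds
      (by simpa using h1.add hz) (fun _ => zero_le) fun n => ?_
    refine le_trans ?_ (add_le_add le_rfl (a1 n))
    have := eLpNorm_add_le (hu.sub (hv n).memLp_fun.1)
      ((hv n).memLp_fun.1.sub ((hφ n).memLp 2 U).1) one_le_two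
    refine le_trans (le_of_eq ?_) this
    congr 1
    ext x
    simp
  · refine tendsto_of_tendsto_of_tendsto_of_le_of_le tendsto_const_nhds
      (by simpa using h2.add hz) (fun _ => zero_le) fun n => ?_
    refine le_trans ?_ (add_le_add le_rfl (a2 n))
    have := eLpNorm_add_le (hg.sub (hv n).memLp_grad.1)
      ((hv n).memLp_grad.1.sub ((hφ n).memLp_gradient 2 U).1) one_le_two
    refine le_trans (le_of_eq ?_) this
    congr 1
    ext x
    simp

theorem congr (hu : MemH10 U u g) (h1 : ∀ᵐ x ∂(volume.restrict U), u x = v x)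
    (h2 : ∀ᵐ x ∂(volume.restrict U), g x = h x) : MemH10 U v h := by
  -- A constant sequence suffices: its distance to the modified pair is zero in `L²`.
  refine of_tendsto (fun _ : ℕ => hu) (hu.memLp_fun.1.congr h1) (hu.memLp_grad.1.congr h2) ?_ ?_
  · rw [eLpNorm_congr_ae (g := 0)]
    · simp
    · filter_upwards [h1] with x hx
      simp [hx]
  · rw [eLpNorm_congr_ae (g := 0)]
    · simp
    · filter_upwards [h2] with x hx
      simp [hx]

theorem add_const_mul (hu : MemH10 U u g) (c : ℝ) (hv : MemH10 U v h) :
    MemH10 U (fun x => u x + c * v x) (fun x => g x + c • h x) := by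
  obtain ⟨φ, hφ, a1, a2, -⟩ := hu.exists_seq
  obtain ⟨ψ, hψ, b1, b2, -⟩ := hv.exists_seq
  refine memH10_of_tendsto_test (φ := fun n x => φ n x + c * ψ n x)
    (fun n => (hφ n).add ((hψ n).const_mul c)) (hu.memLp_fun.1.add (hv.memLp_fun.1.const_mul c))
    (hu.memLp_grad.1.add (hv.memLp_grad.1.const_smul c)) ?_ ?_
  · refine tendsto_of_tendsto_of_tendsto_of_le_of_le tendsto_const_nhds
      (by simpa using a1.add (ENNReal.Tendsto.const_mul b1 (Or.inr (enorm_ne_top (x := c)))))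
      (fun _ => zero_le) fun n => ?_
    have := eLpNorm_add_le (hu.memLp_fun.1.sub ((hφ n).memLp 2 U).1)
      ((hv.memLp_fun.1.sub ((hψ n).memLp 2 U).1).const_smul c) one_le_two
    rw [eLpNorm_const_smul] at this
    refine le_trans (le_of_eq ?_) this
    congr 1
    ext x
    simp
    ring
  · refine tendsto_of_tendsto_of_tendsto_of_le_of_le tendsto_const_nhds
      (by simpa using a2.add (ENNReal.Tendsto.const_mul b2 (Or.inr (enorm_ne_top (x := c)))))
      (fun _ => zero_le) fun n => ?_
    have := eLpNorm_add_le (hu.memLp_grad.1.sub ((hφ n).memLp_gradient 2 U).1)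
      ((hv.memLp_grad.1.sub ((hψ n).memLp_gradient 2 U).1).const_smul c) one_le_two
    rw [eLpNorm_const_smul] at this
    refine le_trans (le_of_eq ?_) this
    congr 1
    ext x : 1
    rw [gradient_add_eq (hφ n).differentiable.differentiableAt
      ((hψ n).const_mul c).differentiable.differentiableAt,
      gradient_const_mul_eq _ (hψ n).differentiable.differentiableAt]
    simp only [Pi.sub_apply, Pi.add_apply, Pi.smul_apply]
    module

theorem sub (hu : MemH10 U u g) (hv : MemH10 U v h) :
    MemH10 U (fun x => u x - v x) (fun x => g x - h x) :=
  (hu.add_const_mul (-1) hv).congr (Eventually.of_forall fun x => by ring)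
    (Eventually.of_forall fun x => by module)

end MemH10

/-! ### Passing to the limit in products; cutoffs of one variable -/

/-- Products of bounded almost everywhere convergent factors with `L²` convergent factors
converge in `L²`. -/
theorem tendsto_eLpNorm_two_smul {α F : Type*} {m : MeasurableSpace α} {μ : Measure α}
    [NormedAddCommGroup F] [NormedSpace ℝ F] {b : ℕ → α → ℝ} {c : α → ℝ} {h : ℕ → α → F}
    {k : α → F} {B : ℝ} (hb : ∀ n, AEStronglyMeasurable (b n) μ) (hc : AEStronglyMeasurable c μ)
    (hB : ∀ n, ∀ᵐ x ∂μ, |b n x| ≤ B) (hbc : ∀ᵐ x ∂μ, Tendsto (fun n => b n x) atTop (𝓝 (c x)))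
    (hh : ∀ n, AEStronglyMeasurable (h n) μ) (hk : MemLp k 2 μ)
    (hhk : Tendsto (fun n => eLpNorm (fun x => k x - h n x) 2 μ) atTop (𝓝 0)) :
    Tendsto (fun n => eLpNorm (fun x => c x • k x - b n x • h n x) 2 μ) atTop (𝓝 0) := by
  have hBall : ∀ᵐ x ∂μ, ∀ n, |b n x| ≤ B := ae_all_iff.2 hB
  -- Splitting: `c k - bₙ hₙ = (c - bₙ) k + bₙ (k - hₙ)`. The first term is dominated by `2B ‖k‖`
  -- because the bound `B` passes to the limit `c`; the second is at most `B` times an `L²` null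
  -- sequence.
  have t1 : Tendsto (fun n => eLpNorm (fun x => (c x - b n x) • k x) 2 μ) atTop (𝓝 0) := by
    refine tendsto_eLpNorm_two_zero_of_dominated (b := fun x => (2 * B) * ‖k x‖)
      (fun n => (hc.sub (hb n)).smul hk.1) (hk.norm.const_mul _) (fun n => ?_) ?_
    · filter_upwards [hBall, hbc] with x hx hl
      rw [norm_smul]
      gcongr
      have h1 : |c x| ≤ B := le_of_tendsto hl.abs (Eventually.of_forall hx)
      rw [Real.norm_eq_abs]
      exact (abs_sub _ _).trans (by linarith [hx n])
    · filter_upwards [hbc] with x hx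
      have : Tendsto (fun n => (c x - b n x) • k x) atTop (𝓝 ((c x - c x) • k x)) :=
        (tendsto_const_nhds.sub hx).smul_const _
      simpa using this
  have t2 : Tendsto (fun n => eLpNorm (fun x => b n x • (k x - h n x)) 2 μ) atTop (𝓝 0) := by
    have hz : Tendsto (fun n => ENNReal.ofReal B * eLpNorm (fun x => k x - h n x) 2 μ) atTop
        (𝓝 0) := by
      simpa using ENNReal.Tendsto.const_mul hhk (Or.inr ENNReal.ofReal_ne_top)
    refine tendsto_of_tendsto_of_tendsto_of_le_of_le tendsto_const_nhds hz (fun _ => zero_le)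
      fun n => ?_
    refine eLpNorm_le_mul_eLpNorm_of_ae_le_mul ?_ _
    filter_upwards [hB n] with x hx
    rw [norm_smul]
    gcongr
    exact hx
  refine tendsto_of_tendsto_of_tendsto_of_le_of_le tendsto_const_nhds
    (by simpa using t1.add t2) (fun _ => zero_le) fun n => ?_
  refine le_trans (le_of_eq ?_) (eLpNorm_add_le ((hc.sub (hb n)).smul hk.1)
    ((hb n).smul (hk.1.sub (hh n))) one_le_two)
  congr 1
  ext x : 1
  simp only [Pi.add_apply]
  module

theorem abs_sub_le_of_abs_deriv_le {G : ℝ → ℝ} (hG : Differentiable ℝ G) {L : ℝ}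
    (hL : ∀ t, |deriv G t| ≤ L) (s t : ℝ) : |G s - G t| ≤ L * |s - t| :=
  convex_univ.norm_image_sub_le_of_norm_deriv_le (fun x _ => hG x) (fun x _ => hL x)
    (mem_univ t) (mem_univ s)

theorem exists_bound_of_bounded_outside {h : ℝ → ℝ} (hh : Continuous h) {R B : ℝ}
    (hB : ∀ t, R < |t| → |h t| ≤ B) : ∃ L, 0 ≤ L ∧ ∀ t, |h t| ≤ L := by
  obtain ⟨C, hC⟩ := (isCompact_Icc (a := -R) (b := R)).exists_bound_of_continuousOn hh.continuousOn
  refine ⟨max (max B C) 0, le_max_right _ _, fun t => ?_⟩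
  rcases lt_or_ge R |t| with ht | ht
  · exact (hB t ht).trans ((le_max_left _ _).trans (le_max_left _ _))
  · exact (hC t (abs_le.1 ht)).trans ((le_max_right _ _).trans (le_max_left _ _))

theorem deriv_smoothTransition_eq_zero {t : ℝ} (ht : 1 < |t|) :
    deriv Real.smoothTransition t = 0 := by
  rcases lt_or_ge 0 t with h | h
  · rw [abs_of_pos h] at ht
    have : Real.smoothTransition =ᶠ[𝓝 t] fun _ => 1 := by
      filter_upwards [lt_mem_nhds ht] with s hs using Real.smoothTransition.one_of_one_le hs.le
    rw [this.deriv_eq, deriv_const]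
  · rw [abs_of_nonpos h] at ht
    have : Real.smoothTransition =ᶠ[𝓝 t] fun _ => 0 := by
      filter_upwards [gt_mem_nhds (by linarith : t < 0)] with s hs using
        Real.smoothTransition.zero_of_nonpos hs.le
    rw [this.deriv_eq, deriv_const]

/-- A smooth cutoff on the line, `1` on `(-∞, -a]` and `0` on `[-a/2, ∞)`. -/
theorem exists_cutoff_neg {a : ℝ} (ha : 0 < a) : ∃ χ : ℝ → ℝ, ContDiff ℝ ∞ χ ∧
    (∀ t, -(a / 2) ≤ t → χ t = 0) ∧ (∀ t, t ≤ -a → χ t = 1) ∧ (∀ t, |χ t| ≤ 1) ∧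
    ∃ B, 0 ≤ B ∧ ∀ t, |deriv χ t| ≤ B := by
  have hs : ContDiff ℝ ∞ Real.smoothTransition := Real.smoothTransition.contDiff (n := ⊤)
  obtain ⟨L, hL0, hL⟩ := exists_bound_of_bounded_outside (R := 1) (B := 0)
    (hs.continuous_deriv (by simp)) (fun t ht => by simp [deriv_smoothTransition_eq_zero ht])
  -- The affine map sends `-a/2` to `0` and `-a` to `1`, the ends of the transition.
  refine ⟨fun t => Real.smoothTransition (-(2 / a) * t - 1), hs.comp (by fun_prop), ?_, ?_, ?_,
    L * (2 / a), by positivity, ?_⟩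
  · intro t ht
    apply Real.smoothTransition.zero_of_nonpos
    have : 2 / a * t ≥ 2 / a * (-(a / 2)) := by gcongr
    have e : 2 / a * (-(a / 2)) = -1 := by field_simp
    linarith
  · intro t ht
    apply Real.smoothTransition.one_of_one_le
    have : 2 / a * t ≤ 2 / a * (-a) := by gcongr
    have e : 2 / a * (-a) = -2 := by field_simp
    linarith
  · intro t
    rw [abs_of_nonneg (Real.smoothTransition.nonneg _)]
    exact Real.smoothTransition.le_one _
  · intro t
    have h1 : HasDerivAt (fun t : ℝ => -(2 / a) * t - 1) (-(2 / a)) t := by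
      simpa using ((hasDerivAt_id t).const_mul (-(2 / a))).sub_const 1
    have h2 := ((hs.differentiable (by simp)) (-(2 / a) * t - 1)).hasDerivAt.comp t h1
    have h3 : deriv (fun t => Real.smoothTransition (-(2 / a) * t - 1)) t = _ := h2.deriv
    rw [h3, abs_mul, abs_neg, abs_of_pos (by positivity : 0 < 2 / a)]
    gcongr
    exact hL _

/-- Smooth approximation of the negative part. -/
def negCut (t : ℝ) : ℝ := -t * Real.smoothTransition (-t - 1)

theorem contDiff_negCut : ContDiff ℝ ∞ negCut := by
  have hs : ContDiff ℝ ∞ Real.smoothTransition := Real.smoothTransition.contDiff (n := ⊤)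
  exact contDiff_neg.mul (hs.comp (by fun_prop))

theorem negCut_of_le {t : ℝ} (ht : -1 ≤ t) : negCut t = 0 := by
  rw [negCut, Real.smoothTransition.zero_of_nonpos (by linarith), mul_zero]

theorem negCut_of_ge {t : ℝ} (ht : t ≤ -2) : negCut t = -t := by
  rw [negCut, Real.smoothTransition.one_of_one_le (by linarith), mul_one]

theorem abs_negCut_le (t : ℝ) : |negCut t| ≤ |t| := by
  rw [negCut, abs_mul, abs_neg, abs_of_nonneg (Real.smoothTransition.nonneg _)]
  exact mul_le_of_le_one_right (abs_nonneg _) (Real.smoothTransition.le_one _)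

theorem deriv_negCut_of_lt {t : ℝ} (ht : -1 < t) : deriv negCut t = 0 := by
  have : negCut =ᶠ[𝓝 t] fun _ => 0 := by
    filter_upwards [lt_mem_nhds ht] with s hs using negCut_of_le hs.le
  rw [this.deriv_eq, deriv_const]

theorem deriv_negCut_of_gt {t : ℝ} (ht : t < -2) : deriv negCut t = -1 := by
  have : negCut =ᶠ[𝓝 t] fun s => -s := by
    filter_upwards [gt_mem_nhds ht] with s hs using negCut_of_ge hs.le
  rw [this.deriv_eq, deriv_neg]

theorem exists_bound_deriv_negCut : ∃ L, 0 ≤ L ∧ ∀ t, |deriv negCut t| ≤ L := by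
  refine exists_bound_of_bounded_outside (R := 2) (B := 1)
    (contDiff_negCut.continuous_deriv (by simp)) fun t ht => ?_
  rcases lt_abs.1 ht with h | h
  · simp [deriv_negCut_of_lt (by linarith : -1 < t)]
  · simp [deriv_negCut_of_gt (by linarith : t < -2)]

/-- Rescaled smooth approximation of the negative part, converging to it as `c → ∞`. -/
def negApprox (c t : ℝ) : ℝ := c⁻¹ * negCut (c * t)

theorem contDiff_negApprox (c : ℝ) : ContDiff ℝ ∞ (negApprox c) :=
  contDiff_const.mul (contDiff_negCut.comp (by fun_prop))

theorem deriv_negApprox {c : ℝ} (hc : 0 < c) (t : ℝ) :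
    deriv (negApprox c) t = deriv negCut (c * t) := by
  have h1 : HasDerivAt (fun t : ℝ => c * t) c t := by
    simpa using (hasDerivAt_id t).const_mul c
  have h2 := (((contDiff_negCut.differentiable (by simp)) (c * t)).hasDerivAt.comp t h1).const_mul c⁻¹
  have h3 : deriv (negApprox c) t = _ := h2.deriv
  rw [h3]
  field_simp

theorem abs_negApprox_le {c : ℝ} (hc : 0 < c) (t : ℝ) : |negApprox c t| ≤ |t| := by
  rw [negApprox, abs_mul, abs_of_pos (inv_pos.2 hc)]
  calc c⁻¹ * |negCut (c * t)| ≤ c⁻¹ * |c * t| :=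
        mul_le_mul_of_nonneg_left (abs_negCut_le _) (inv_pos.2 hc).le
    _ = |t| := by rw [abs_mul, abs_of_pos hc]; field_simp

theorem negApprox_of_le {c t : ℝ} (hc : 0 < c) (ht : -c⁻¹ ≤ t) : negApprox c t = 0 := by
  rw [negApprox, negCut_of_le, mul_zero]
  have : c * -c⁻¹ ≤ c * t := by gcongr
  rwa [mul_neg, mul_inv_cancel₀ hc.ne'] at this

theorem deriv_negApprox_of_lt {c t : ℝ} (hc : 0 < c) (ht : -c⁻¹ < t) :
    deriv (negApprox c) t = 0 := by
  rw [deriv_negApprox hc, deriv_negCut_of_lt]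
  have : c * -c⁻¹ < c * t := by gcongr
  rwa [mul_neg, mul_inv_cancel₀ hc.ne'] at this

theorem negApprox_zero {c : ℝ} (hc : 0 < c) : negApprox c 0 = 0 :=
  negApprox_of_le hc (by simpa using hc.le)

/-! ### Chain rule, product rule and negative part in `H¹₀` -/

namespace MemH10

variable {u v : EuclideanSpace ℝ (Fin N) → ℝ}
  {g h : EuclideanSpace ℝ (Fin N) → EuclideanSpace ℝ (Fin N)}

/-- Chain rule in `H¹₀` for smooth functions with bounded derivative. -/
theorem comp (hu : MemH10 U u g) {G : ℝ → ℝ} (hG : ContDiff ℝ ∞ G) (h0 : G 0 = 0) {L : ℝ}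
    (hL : ∀ t, |deriv G t| ≤ L) :
    MemH10 U (fun x => G (u x)) (fun x => deriv G (u x) • g x) := by
  obtain ⟨φ, hφ, a1, a2, a3⟩ := hu.exists_seq
  have hd : Differentiable ℝ G := hG.differentiable (by simp)
  have hdc : Continuous (deriv G) := hG.continuous_deriv (by simp)
  have m2 : AEStronglyMeasurable (fun x => deriv G (u x)) (volume.restrict U) :=
    hdc.comp_aestronglyMeasurable hu.memLp_fun.1
  refine memH10_of_tendsto_test (fun n => (hφ n).comp hG h0)
    (hG.continuous.comp_aestronglyMeasurable hu.memLp_fun.1) (m2.smul hu.memLp_grad.1) ?_ ?_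
  · have hz : Tendsto (fun n => ENNReal.ofReal L *
        eLpNorm (fun x => u x - φ n x) 2 (volume.restrict U)) atTop (𝓝 0) := by
      simpa using ENNReal.Tendsto.const_mul a1 (Or.inr ENNReal.ofReal_ne_top)
    refine tendsto_of_tendsto_of_tendsto_of_le_of_le tendsto_const_nhds hz (fun _ => zero_le)
      fun n => ?_
    exact eLpNorm_le_mul_eLpNorm_of_ae_le_mul
      (Eventually.of_forall fun x => abs_sub_le_of_abs_deriv_le hd hL _ _) _
  -- Only almost everywhere convergence of `deriv G (φ n x)` is available, which is enough because
  -- these factors are uniformly bounded by `L`.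
  · have := tendsto_eLpNorm_two_smul (μ := volume.restrict U)
      (b := fun n x => deriv G (φ n x)) (c := fun x => deriv G (u x))
      (h := fun n => gradient (φ n)) (k := g) (B := L)
      (fun n => (hdc.comp (hφ n).continuous).aestronglyMeasurable) m2
      (fun n => Eventually.of_forall fun x => hL _)
      (a3.mono fun x hx => (hdc.tendsto _).comp hx)
      (fun n => ((hφ n).memLp_gradient 2 U).1) hu.memLp_grad a2
    refine this.congr fun n => ?_
    congr 1
    ext x : 1
    rw [gradient_comp_eq (hd _) ((hφ n).differentiable _)]

/-- The product of an element of `H¹₀(Ω)` with a test function of `U ⊆ Ω` is in `H¹₀(U)`. -/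
theorem test_mul (hu : MemH10 Ω u g) (hUΩ : U ⊆ Ω) {ξ : EuclideanSpace ℝ (Fin N) → ℝ}
    (hξ : IsTestFunction U ξ) :
    MemH10 U (fun x => ξ x * u x) (fun x => ξ x • g x + u x • gradient ξ x) := by
  obtain ⟨φ, hφ, a1, a2, -⟩ := hu.exists_seq
  obtain ⟨B, hB0, hB⟩ := hξ.exists_bound
  obtain ⟨D, hD0, hD⟩ := hξ.exists_bound_gradient
  have hle : volume.restrict U ≤ volume.restrict Ω := Measure.restrict_mono_set _ hUΩ
  have b1 := tendsto_of_tendsto_of_tendsto_of_le_of_le tendsto_const_nhds a1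
    (fun _ => zero_le) fun n => eLpNorm_mono_measure (p := 2) (fun x => u x - φ n x) hle
  have b2 := tendsto_of_tendsto_of_tendsto_of_le_of_le tendsto_const_nhds a2
    (fun _ => zero_le) fun n => eLpNorm_mono_measure (p := 2) (fun x => g x - gradient (φ n) x) hle
  have mu := hu.memLp_fun.mono_measure hle
  have mg := hu.memLp_grad.mono_measure hle
  have mξ := (hξ.memLp 2 U).1
  have mdξ := (hξ.memLp_gradient 2 U).1
  have hz : ∀ (c : ℝ), Tendsto (fun n => ENNReal.ofReal c *
      eLpNorm (fun x => u x - φ n x) 2 (volume.restrict U)) atTop (𝓝 0) := fun c => by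
    simpa using ENNReal.Tendsto.const_mul b1 (Or.inr ENNReal.ofReal_ne_top)
  have hz2 : Tendsto (fun n => ENNReal.ofReal B *
      eLpNorm (fun x => g x - gradient (φ n) x) 2 (volume.restrict U)) atTop (𝓝 0) := by
    simpa using ENNReal.Tendsto.const_mul b2 (Or.inr ENNReal.ofReal_ne_top)
  refine memH10_of_tendsto_test (fun n => hξ.mul (hφ n).smooth) (mξ.mul mu.1)
    ((mξ.smul mg.1).add (mu.1.smul mdξ)) ?_ ?_
  · refine tendsto_of_tendsto_of_tendsto_of_le_of_le tendsto_const_nhds (hz B)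
      (fun _ => zero_le) fun n => ?_
    refine eLpNorm_le_mul_eLpNorm_of_ae_le_mul (Eventually.of_forall fun x => ?_) _
    rw [← mul_sub, norm_mul]
    gcongr
    exact hB x
  · refine tendsto_of_tendsto_of_tendsto_of_le_of_le tendsto_const_nhds
      (by simpa using hz2.add (hz D)) (fun _ => zero_le) fun n => ?_
    -- The gradient error of the product is `ξ (g - ∇φₙ) + (u - φₙ) ∇ξ`; both terms are controlled
    -- by the sup norms of `ξ` and `∇ξ`.
    have c1 : eLpNorm (fun x => ξ x • (g x - gradient (φ n) x)) 2 (volume.restrict U) ≤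
        ENNReal.ofReal B * eLpNorm (fun x => g x - gradient (φ n) x) 2 (volume.restrict U) := by
      refine eLpNorm_le_mul_eLpNorm_of_ae_le_mul (Eventually.of_forall fun x => ?_) _
      rw [norm_smul]
      gcongr
      exact hB x
    have c2 : eLpNorm (fun x => (u x - φ n x) • gradient ξ x) 2 (volume.restrict U) ≤
        ENNReal.ofReal D * eLpNorm (fun x => u x - φ n x) 2 (volume.restrict U) := by
      refine eLpNorm_le_mul_eLpNorm_of_ae_le_mul (Eventually.of_forall fun x => ?_) _
      rw [norm_smul, mul_comm]
      gcongr
      exact hD x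
    refine le_trans (le_of_eq ?_) ((eLpNorm_add_le
      (mξ.smul (mg.1.sub ((hφ n).memLp_gradient 2 U).1))
      ((mu.1.sub ((hφ n).memLp 2 U).1).smul mdξ) one_le_two).trans (add_le_add c1 c2))
    congr 1
    ext x : 1
    rw [gradient_mul_eq (hξ.differentiable _) ((hφ n).differentiable _)]
    simp only [Pi.add_apply, Pi.smul_apply', Pi.sub_apply]
    module

/-- Passage from the smooth approximations to the negative part. -/
theorem negPart_of_negApprox (hu : MemLp u 2 (volume.restrict U))
    (hg : MemLp g 2 (volume.restrict U))
    (H : ∀ c : ℝ, 0 < c → MemH10 U (fun x => negApprox c (u x))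
      (fun x => deriv (negApprox c) (u x) • g x)) :
    MemH10 U (fun x => max (-u x) 0) (fun x => (if u x < 0 then (-1 : ℝ) else 0) • g x) := by
  obtain ⟨L, hL0, hL⟩ := exists_bound_deriv_negCut
  have hc : ∀ n : ℕ, (0 : ℝ) < n + 1 := fun n => by positivity
  -- For fixed `t < 0` the rescaled argument eventually lies below `-2`, where `negCut` is exactly
  -- `-t`. Both pointwise limits are therefore eventually constant sequences, also for `t ≥ 0`.
  have hlarge : ∀ t : ℝ, t < 0 → ∀ᶠ n : ℕ in atTop, ((n : ℝ) + 1) * t < -2 := fun t ht => by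
    have h1 : Tendsto (fun n : ℕ => (n : ℝ) + 1) atTop atTop :=
      tendsto_atTop_add_const_right _ _ tendsto_natCast_atTop_atTop
    exact (h1.atTop_mul_const_of_neg ht).eventually (eventually_lt_atBot _)
  have mite : AEStronglyMeasurable (fun x => if u x < 0 then (-1 : ℝ) else 0)
      (volume.restrict U) :=
    ((Measurable.ite (measurableSet_Iio (a := (0 : ℝ))) measurable_const
      measurable_const).comp_aemeasurable hu.1.aemeasurable).aestronglyMeasurable
  have mneg : AEStronglyMeasurable (fun x => max (-u x) 0) (volume.restrict U) :=
    (by fun_prop : Continuous fun t : ℝ => max (-t) 0).comp_aestronglyMeasurable hu.1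
  refine of_tendsto (fun n : ℕ => H (n + 1) (hc n)) mneg (mite.smul hg.1) ?_ ?_
  · refine tendsto_eLpNorm_two_zero_of_dominated (b := fun x => 2 * |u x|)
      (fun n => mneg.sub (H (n + 1) (hc n)).memLp_fun.1) (hu.abs.const_mul 2)
      (fun n => Eventually.of_forall fun x => ?_) (Eventually.of_forall fun x => ?_)
    · have h1 : |max (-u x) 0| ≤ |u x| := by
        rw [abs_of_nonneg (le_max_right _ _)]
        exact max_le (neg_le_abs _) (abs_nonneg _)
      have h2 := abs_negApprox_le (hc n) (u x)
      rw [Real.norm_eq_abs]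
      exact (abs_sub _ _).trans (by linarith)
    · refine tendsto_const_nhds.congr' ?_
      rcases lt_or_ge (u x) 0 with hx | hx
      · filter_upwards [hlarge _ hx] with n hn
        rw [negApprox, negCut_of_ge hn.le, max_eq_left (by linarith)]
        have := (hc n).ne'
        field_simp
        ring
      · filter_upwards with n
        rw [negApprox_of_le (hc n) ((neg_nonpos.2 (inv_nonneg.2 (hc n).le)).trans hx),
          max_eq_right (by linarith), sub_zero]
  · have := tendsto_eLpNorm_two_smul (μ := volume.restrict U)
      (b := fun n x => deriv (negApprox ((n : ℝ) + 1)) (u x))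
      (c := fun x => if u x < 0 then (-1 : ℝ) else 0)
      (h := fun _ => g) (k := g) (B := L)
      (fun n => ((contDiff_negApprox _).continuous_deriv
        (by simp)).comp_aestronglyMeasurable hu.1) mite
      (fun n => Eventually.of_forall fun x => by rw [deriv_negApprox (hc n)]; exact hL _)
      (Eventually.of_forall fun x => ?_) (fun n => hg.1) hg (by simp)
    · exact this
    · refine tendsto_const_nhds.congr' ?_
      rcases lt_or_ge (u x) 0 with hx | hx
      · filter_upwards [hlarge _ hx] with n hn
        rw [deriv_negApprox (hc n), deriv_negCut_of_gt hn, if_pos hx]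
      · filter_upwards with n
        rw [deriv_negApprox_of_lt (hc n) ((neg_lt_zero.2 (inv_pos.2 (hc n))).trans_le hx),
          if_neg (not_lt.2 hx)]

theorem comp_negApprox (hu : MemH10 U u g) {c : ℝ} (hc : 0 < c) :
    MemH10 U (fun x => negApprox c (u x))
      (fun x => deriv (negApprox c) (u x) • g x) := by
  obtain ⟨L, hL0, hL⟩ := exists_bound_deriv_negCut
  exact hu.comp (contDiff_negApprox c) (negApprox_zero hc) (L := L) fun t => by
    rw [deriv_negApprox hc]; exact hL _

/-- The negative part of an element of `H¹₀(U)`. -/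
theorem negPart (hu : MemH10 U u g) :
    MemH10 U (fun x => max (-u x) 0) (fun x => (if u x < 0 then (-1 : ℝ) else 0) • g x) :=
  negPart_of_negApprox hu.memLp_fun hu.memLp_grad fun _ hc => hu.comp_negApprox hc

end MemH10

/-! ### The negative part in `H¹₀` of a smaller open set -/

/-- A compact set between `K` and `U` gives the compact support. Equality to `1` is required near
each point of `K`, not just on `K`, so that the gradient vanishes there too. -/
theorem exists_isTestFunction_eq_one {K : Set (EuclideanSpace ℝ (Fin N))} (hK : IsCompact K)
    (hU : IsOpen U) (hKU : K ⊆ U) :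
    ∃ ζ, IsTestFunction U ζ ∧ ∀ x ∈ K, ζ =ᶠ[𝓝 x] fun _ => 1 := by
  obtain ⟨L, hL, hKL, hLU⟩ := exists_compact_between hK hU hKU
  obtain ⟨f, h1, h0, -⟩ := exists_contMDiffMap_one_nhds_of_subset_interior
    (n := ⊤) (modelWithCornersSelf ℝ (EuclideanSpace ℝ (Fin N))) hK.isClosed hKL
  have hs : tsupport f ⊆ L := closure_minimal (fun x hx => by
    by_contra h
    exact hx (h0 x h)) hL.isClosed
  exact ⟨f, ⟨f.contMDiff.contDiff, HasCompactSupport.of_support_subset_isCompact hL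
    (subset_closure.trans hs), hs.trans hLU⟩, fun x hx => (eventually_nhdsSet_iff_forall.1 h1) x hx⟩

/-- A bounded element of `H¹₀(Ω)` that is continuous on `Ω` and nonnegative outside of an open
set `U ⊆ Ω` has its negative part in `H¹₀(U)`. -/
theorem MemH10.negPart_of_continuousOn {u : EuclideanSpace ℝ (Fin N) → ℝ}
    {g : EuclideanSpace ℝ (Fin N) → EuclideanSpace ℝ (Fin N)} (hu : MemH10 Ω u g)
    (hU : IsOpen U) (hUΩ : U ⊆ Ω) (hc : ContinuousOn u Ω) {K : ℝ}
    (hK : ∀ᵐ x ∂(volume.restrict Ω), |u x| ≤ K) (hneg : ∀ x ∈ Ω, u x < 0 → x ∈ U) :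
    MemH10 U (fun x => max (-u x) 0) (fun x => (if u x < 0 then (-1 : ℝ) else 0) • g x) := by
  have hle : volume.restrict U ≤ volume.restrict Ω := Measure.restrict_mono_set _ hUΩ
  have mu := hu.memLp_fun.mono_measure hle
  have mg := hu.memLp_grad.mono_measure hle
  refine MemH10.negPart_of_negApprox mu mg fun c hc0 => ?_
  -- The cutoff is `1` wherever `negApprox c` is nonzero, and it vanishes near `0`, so `χ ∘ φ n` is
  -- again a test function.
  obtain ⟨χ, hχ, hχ0, hχ1, hχb, B, hB0, hB⟩ := exists_cutoff_neg (inv_pos.2 hc0)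
  have hχz : χ 0 = 0 := hχ0 0 (neg_nonpos.2 (by positivity))
  have hdχ : Continuous (deriv χ) := hχ.continuous_deriv (by simp)
  obtain ⟨φ, hφ, a1, a2, a3⟩ := hu.exists_seq
  have b2 := tendsto_of_tendsto_of_tendsto_of_le_of_le tendsto_const_nhds a2
    (fun _ => zero_le) fun n => eLpNorm_mono_measure (p := 2) (fun x => g x - gradient (φ n) x) hle
  have b3 := a3.filter_mono (ae_mono hle)
  have hKU := hK.filter_mono (ae_mono hle)
  have hw := hu.comp_negApprox hc0
  have mw := hw.memLp_fun.mono_measure hle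
  have mh := hw.memLp_grad.mono_measure hle
  have key : ∀ n, MemH10 U (fun x => χ (φ n x) * negApprox c (u x))
      (fun x => χ (φ n x) • (deriv (negApprox c) (u x) • g x) +
        (deriv χ (φ n x) * negApprox c (u x)) • gradient (φ n) x) := by
    intro n
    -- This is where continuity of `u` enters: the sublevel set is closed relative to `tsupport (φ
    -- n) ⊆ Ω`. Off this compact set the product `χ(φₙ) negApprox c (u)` is zero, so multiplying by
    -- `ζ` changes nothing.
    have hcK : IsCompact (tsupport (φ n) ∩ {x | u x ≤ -c⁻¹}) := by
      have h1 : IsClosed (tsupport (φ n) ∩ u ⁻¹' Iic (-c⁻¹)) :=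
        (hc.mono (hφ n).support).preimage_isClosed_of_isClosed (isClosed_tsupport _) isClosed_Iic
      exact (hφ n).compact.isCompact.of_isClosed_subset h1 inter_subset_left
    have hsub : tsupport (φ n) ∩ {x | u x ≤ -c⁻¹} ⊆ U := fun x hx =>
      hneg x ((hφ n).support hx.1) (lt_of_le_of_lt hx.2 (neg_lt_zero.2 (inv_pos.2 hc0)))
    obtain ⟨ζ, hζ, hζ1⟩ := exists_isTestFunction_eq_one hcK hU hsub
    have hχφ := (hφ n).comp hχ hχz
    have hm := hw.test_mul hUΩ (hζ.mul hχφ.smooth)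
    refine hm.congr (Eventually.of_forall fun x => ?_) (Eventually.of_forall fun x => ?_)
    · by_cases hx : x ∈ tsupport (φ n)
      · rcases le_or_gt (u x) (-c⁻¹) with hux | hux
        · simp [(hζ1 x ⟨hx, hux⟩).self_of_nhds]
        · simp [negApprox_of_le hc0 hux.le]
      · simp [image_eq_zero_of_notMem_tsupport hx, hχz]
    · rw [gradient_mul_eq (hζ.differentiable _) (hχφ.differentiable _),
        gradient_comp_eq (hχ.differentiable (by simp) _) ((hφ n).differentiable _)]
      by_cases hx : x ∈ tsupport (φ n)
      · rcases le_or_gt (u x) (-c⁻¹) with hux | hux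
        · have h1 := hζ1 x ⟨hx, hux⟩
          rw [h1.self_of_nhds, h1.gradient_eq, gradient_fun_const]
          module
        · simp [negApprox_of_le hc0 hux.le, deriv_negApprox_of_lt hc0 hux]
      · simp [image_eq_zero_of_notMem_tsupport hx, hχz,
          IsTestFunction.gradient_eq_zero_of_notMem_tsupport hx]
  have e1 : ∀ t, χ t * negApprox c t = negApprox c t := fun t => by
    rcases le_or_gt t (-c⁻¹) with h | h
    · rw [hχ1 t h, one_mul]
    · rw [negApprox_of_le hc0 h.le, mul_zero]
  have e2 : ∀ t, χ t * deriv (negApprox c) t = deriv (negApprox c) t := fun t => by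
    rcases le_or_gt t (-c⁻¹) with h | h
    · rw [hχ1 t h, one_mul]
    · rw [deriv_negApprox_of_lt hc0 h, mul_zero]
  -- The unwanted term of the product rule disappears in the limit: `χ' = 0` below `-1/c`, and
  -- `negApprox c = 0` from `-1/c` on.
  have e3 : ∀ t, deriv χ t * negApprox c t = 0 := fun t => by
    rcases lt_or_ge t (-c⁻¹) with h | h
    · have : χ =ᶠ[𝓝 t] fun _ => 1 := by
        filter_upwards [gt_mem_nhds h] with s hs using hχ1 s hs.le
      rw [this.deriv_eq, deriv_const, zero_mul]
    · rw [negApprox_of_le hc0 h, mul_zero]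
  have hχφm : ∀ n, AEStronglyMeasurable (fun x => χ (φ n x)) (volume.restrict U) :=
    fun n => (hχ.continuous.comp (hφ n).continuous).aestronglyMeasurable
  have hχum : AEStronglyMeasurable (fun x => χ (u x)) (volume.restrict U) :=
    hχ.continuous.comp_aestronglyMeasurable mu.1
  have lim : ∀ᵐ x ∂(volume.restrict U), Tendsto (fun n => χ (φ n x)) atTop (𝓝 (χ (u x))) :=
    b3.mono fun x hx => (hχ.continuous.tendsto _).comp hx
  refine MemH10.of_tendsto key mw.1 mh.1 ?_ ?_
  · refine (tendsto_eLpNorm_two_smul (μ := volume.restrict U) (b := fun n x => χ (φ n x))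
      (c := fun x => χ (u x)) (h := fun _ x => negApprox c (u x))
      (k := fun x => negApprox c (u x)) (B := 1) hχφm hχum
      (fun n => Eventually.of_forall fun x => hχb _) lim (fun _ => mw.1) mw
      (by simp)).congr fun n => ?_
    simp only [smul_eq_mul, e1]
  · have t1 := tendsto_eLpNorm_two_smul (μ := volume.restrict U) (b := fun n x => χ (φ n x))
      (c := fun x => χ (u x)) (h := fun _ x => deriv (negApprox c) (u x) • g x)
      (k := fun x => deriv (negApprox c) (u x) • g x) (B := 1) hχφm hχum
      (fun n => Eventually.of_forall fun x => hχb _) lim (fun _ => mh.1) mh (by simp)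
    have mb : ∀ n, AEStronglyMeasurable (fun x => deriv χ (φ n x) * negApprox c (u x))
      (volume.restrict U) :=
      fun n => (hdχ.comp (hφ n).continuous).aestronglyMeasurable.mul mw.1
    -- Here `∇φₙ` converges only in `L²`, so its coefficient must be uniformly bounded. The bound `B
    -- * K` is the reason for requiring `u` to be bounded.
    have t2 := tendsto_eLpNorm_two_smul (μ := volume.restrict U)
      (b := fun n x => deriv χ (φ n x) * negApprox c (u x))
      (c := fun x => deriv χ (u x) * negApprox c (u x)) (h := fun n => gradient (φ n))
      (k := g) (B := B * K) mb
      ((hdχ.comp_aestronglyMeasurable mu.1).mul mw.1)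
      (fun n => by
        filter_upwards [hKU] with x hx
        rw [abs_mul]
        exact mul_le_mul (hB _) ((abs_negApprox_le hc0 _).trans hx) (abs_nonneg _) hB0)
      (b3.mono fun x hx => ((hdχ.tendsto _).comp hx).mul_const _)
      (fun n => ((hφ n).memLp_gradient 2 U).1) mg b2
    refine tendsto_of_tendsto_of_tendsto_of_le_of_le tendsto_const_nhds
      (by simpa using t1.add t2) (fun _ => zero_le) fun n => ?_
    refine le_trans (le_of_eq ?_) (eLpNorm_add_le
      ((hχum.smul mh.1).sub ((hχφm n).smul mh.1))
      ((((hdχ.comp_aestronglyMeasurable mu.1).mul mw.1).smul mg.1).sub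
        ((mb n).smul ((hφ n).memLp_gradient 2 U).1)) one_le_two)
    congr 1
    ext x : 1
    simp only [Pi.add_apply, e3, smul_smul, e2]
    module

/-! ### Minimizers of the Rayleigh quotient -/

/-- A closed quadratic form with compact sublevel sets attains its smallest Rayleigh quotient,
and the minimizer satisfies the Euler-Lagrange equation. -/
theorem exists_minimal_rayleigh {H G : Type*} [NormedAddCommGroup H] [InnerProductSpace ℝ H]
    [CompleteSpace H] [NormedAddCommGroup G] [InnerProductSpace ℝ G] [CompleteSpace G]
    (W : Submodule ℝ (H × G)) (hW : IsClosed (W : Set (H × G)))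
    (hcpt : ∀ (R : ℝ) (s : ℕ → H × G), (∀ n, s n ∈ W) → (∀ n, ‖(s n).1‖ ≤ 1) →
      (∀ n, ‖(s n).2‖ ≤ R) → ∃ ns : ℕ → ℕ, StrictMono ns ∧ CauchySeq fun n => (s (ns n)).1)
    (hne : ∃ w ∈ W, w.1 ≠ 0) :
    ∃ m : ℝ, ∃ v ∈ W, v.1 ≠ 0 ∧ (∀ w ∈ W, ⟪v.2, w.2⟫ = m * ⟪v.1, w.1⟫) ∧
      ∀ w ∈ W, m * ‖w.1‖ ^ 2 ≤ ‖w.2‖ ^ 2 := by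
  set S : Set ℝ := (fun w : H × G => ‖w.2‖ ^ 2) '' {w | w ∈ W ∧ ‖w.1‖ = 1} with hS
  have hbdd : BddBelow S := ⟨0, by rintro _ ⟨w, -, rfl⟩; positivity⟩
  have hnorm : ∀ w ∈ W, w.1 ≠ 0 → ‖w.1‖⁻¹ • w ∈ W ∧ ‖(‖w.1‖⁻¹ • w).1‖ = 1 := fun w hw h0 =>
    ⟨W.smul_mem _ hw, by
      rw [Prod.smul_fst, norm_smul, norm_inv, norm_norm, inv_mul_cancel₀ (norm_ne_zero_iff.2 h0)]⟩
  have hSne : S.Nonempty := by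
    obtain ⟨w, hw, h0⟩ := hne
    exact ⟨_, _, hnorm w hw h0, rfl⟩
  set m := sInf S with hm
  have hm0 : 0 ≤ m := le_csInf hSne (by rintro _ ⟨w, -, rfl⟩; positivity)
  have hmin : ∀ w ∈ W, m * ‖w.1‖ ^ 2 ≤ ‖w.2‖ ^ 2 := by
    intro w hw
    by_cases h0 : w.1 = 0
    · simp [h0]
    · have h1 : m ≤ ‖(‖w.1‖⁻¹ • w).2‖ ^ 2 := csInf_le hbdd ⟨_, hnorm w hw h0, rfl⟩
      have hp : 0 < ‖w.1‖ := norm_pos_iff.2 h0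
      rw [Prod.smul_snd, norm_smul, norm_inv, norm_norm, mul_pow, inv_pow] at h1
      calc m * ‖w.1‖ ^ 2 ≤ ((‖w.1‖ ^ 2)⁻¹ * ‖w.2‖ ^ 2) * ‖w.1‖ ^ 2 := by gcongr
        _ = ‖w.2‖ ^ 2 := by field_simp
  have hseq : ∀ n : ℕ, ∃ w ∈ W, ‖w.1‖ = 1 ∧ ‖w.2‖ ^ 2 < m + 1 / ((n : ℝ) + 1) := by
    intro n
    obtain ⟨_, ⟨w, ⟨hw, h1⟩, rfl⟩, hlt⟩ := exists_lt_of_csInf_lt hSne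
      (lt_add_of_pos_right m (by positivity : (0 : ℝ) < 1 / ((n : ℝ) + 1)))
    exact ⟨w, hw, h1, hlt⟩
  choose s hsW hs1 hs2 using hseq
  -- `m + 2` is a convenient bound: `‖(s n).2‖² < m + 1 ≤ (m + 2)²`.
  obtain ⟨ns, hns, hC1⟩ := hcpt (m + 2) s hsW (fun n => (hs1 n).le) (fun n => by
    have h1 := hs2 n
    have h2 : 1 / ((n : ℝ) + 1) ≤ 1 := by
      rw [div_le_one (by positivity)]
      linarith [n.cast_nonneg (α := ℝ)]
    nlinarith [norm_nonneg (s n).2])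
  have hε : Tendsto (fun n => 1 / ((ns n : ℝ) + 1)) atTop (𝓝 0) :=
    tendsto_one_div_add_atTop_nhds_zero_nat.comp hns.tendsto_atTop
  -- Parallelogram law in both components, with the sum bounded below by minimality: closeness of
  -- the first components forces closeness of the second ones along a minimizing sequence.
  have hsq : ∀ a b, ‖(s (ns a)).2 - (s (ns b)).2‖ ^ 2 ≤ 2 * (1 / ((ns a : ℝ) + 1)) +
      2 * (1 / ((ns b : ℝ) + 1)) + m * ‖(s (ns a)).1 - (s (ns b)).1‖ ^ 2 := by
    intro a b
    have p1 := parallelogram_law_with_norm ℝ (s (ns a)).1 (s (ns b)).1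
    have p2 := parallelogram_law_with_norm ℝ (s (ns a)).2 (s (ns b)).2
    have h1 := hmin _ (W.add_mem (hsW (ns a)) (hsW (ns b)))
    rw [Prod.fst_add, Prod.snd_add] at h1
    rw [hs1, hs1] at p1
    have h2 := hs2 (ns a)
    have h3 := hs2 (ns b)
    have p1' : ‖(s (ns a)).1 + (s (ns b)).1‖ ^ 2 =
      4 - ‖(s (ns a)).1 - (s (ns b)).1‖ ^ 2 := by linarith
    rw [p1'] at h1
    nlinarith
  have hC2 : CauchySeq fun n => (s (ns n)).2 := by
    rw [Metric.cauchySeq_iff]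
    intro ε hεp
    -- The three terms of `hsq` sum to at most `(2 + 2 + 1) ε²/6 < ε²`. The divisor `m + 1` covers
    -- the case `m = 0`.
    have hd : 0 < ε ^ 2 / (6 * (m + 1)) := by positivity
    have hd' : 0 < ε ^ 2 / 6 := by positivity
    obtain ⟨n1, hn1⟩ := Metric.cauchySeq_iff.1 hC1 (Real.sqrt (ε ^ 2 / (6 * (m + 1))))
      (Real.sqrt_pos.2 hd)
    obtain ⟨n2, hn2⟩ := eventually_atTop.1 (hε.eventually (gt_mem_nhds hd'))
    refine ⟨max n1 n2, fun a ha b hb => ?_⟩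
    have h1 := hn1 a (le_trans (le_max_left _ _) ha) b (le_trans (le_max_left _ _) hb)
    have h2 := hn2 a (le_trans (le_max_right _ _) ha)
    have h3 := hn2 b (le_trans (le_max_right _ _) hb)
    rw [dist_eq_norm] at h1 ⊢
    have h4 : ‖(s (ns a)).1 - (s (ns b)).1‖ ^ 2 < ε ^ 2 / (6 * (m + 1)) := by
      rw [← Real.sq_sqrt hd.le]
      gcongr
    have h5 : m * ‖(s (ns a)).1 - (s (ns b)).1‖ ^ 2 ≤ ε ^ 2 / 6 := by
      have : m * ‖(s (ns a)).1 - (s (ns b)).1‖ ^ 2 ≤ (m + 1) * (ε ^ 2 / (6 * (m + 1))) := by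
        gcongr
        linarith
      refine this.trans (le_of_eq ?_)
      field_simp
    have h6 := hsq a b
    have h7 : ‖(s (ns a)).2 - (s (ns b)).2‖ ^ 2 < ε ^ 2 := by linarith
    exact lt_of_pow_lt_pow_left₀ 2 hεp.le h7
  obtain ⟨v1, hv1⟩ := cauchySeq_tendsto_of_complete hC1
  obtain ⟨v2, hv2⟩ := cauchySeq_tendsto_of_complete hC2
  have hvW : (v1, v2) ∈ W := hW.mem_of_tendsto (hv1.prodMk_nhds hv2)
    (Eventually.of_forall fun n => hsW (ns n))
  have hn1 : ‖v1‖ = 1 := tendsto_nhds_unique hv1.norm (by simp [hs1])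
  have hn2 : ‖v2‖ ^ 2 ≤ m := by
    have : Tendsto (fun n => m + 1 / ((ns n : ℝ) + 1)) atTop (𝓝 (m + 0)) := hε.const_add m
    rw [add_zero] at this
    exact le_of_tendsto_of_tendsto (hv2.norm.pow 2) this
      (Eventually.of_forall fun n => (hs2 (ns n)).le)
  refine ⟨m, (v1, v2), hvW, fun h => by simp [show v1 = 0 from h] at hn1, fun w hw => ?_, hmin⟩
  -- First variation: minimality at `v + t w` is a nonnegative quadratic in `t` without constant
  -- term, so its discriminant forces the linear coefficient to vanish.
  have hq : ∀ t : ℝ, 0 ≤ (‖w.2‖ ^ 2 - m * ‖w.1‖ ^ 2) * (t * t) +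
      (2 * (⟪v2, w.2⟫ - m * ⟪v1, w.1⟫)) * t + 0 := by
    intro t
    have h1 := hmin _ (W.add_mem hvW (W.smul_mem t hw))
    simp only [Prod.fst_add, Prod.snd_add, Prod.smul_fst, Prod.smul_snd] at h1
    rw [norm_add_sq_real, norm_add_sq_real, norm_smul, norm_smul, inner_smul_right,
      inner_smul_right, hn1, mul_pow, mul_pow, Real.norm_eq_abs, sq_abs] at h1
    nlinarith
  have hd := discrim_le_zero hq
  rw [discrim, mul_zero, sub_zero] at hd
  have : 2 * (⟪v2, w.2⟫ - m * ⟪v1, w.1⟫) = 0 := by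
    nlinarith [sq_nonneg (2 * (⟪v2, w.2⟫ - m * ⟪v1, w.1⟫)), sq_eq_zero_iff.1
      (le_antisymm hd (sq_nonneg (2 * (⟪v2, w.2⟫ - m * ⟪v1, w.1⟫))))]
  linarith

/-! ### Rellich compactness by ball averages -/

/-- Monotonicity of `L^p` norms on a probability space. It moves the square inside the averages over
segments and over balls below. -/
theorem sq_lintegral_enorm_le {α F : Type*} {m : MeasurableSpace α} {μ : Measure α}
    [IsProbabilityMeasure μ] [NormedAddCommGroup F] {f : α → F} (hf : AEStronglyMeasurable f μ) :
    (∫⁻ x, ‖f x‖ₑ ∂μ) ^ 2 ≤ ∫⁻ x, ‖f x‖ₑ ^ 2 ∂μ := by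
  have h := eLpNorm_le_eLpNorm_of_exponent_le (μ := μ) (p := 1) (q := 2) one_le_two hf
  rw [eLpNorm_one_eq_lintegral_enorm,
    eLpNorm_eq_lintegral_rpow_enorm_toReal two_ne_zero ENNReal.ofNat_ne_top] at h
  have h2 := pow_le_pow_left₀ zero_le h 2
  refine h2.trans (le_of_eq ?_)
  rw [← ENNReal.rpow_natCast, ← ENNReal.rpow_mul]
  simp

theorem eLpNorm_two_sq {α F : Type*} {m : MeasurableSpace α} {μ : Measure α}
    [NormedAddCommGroup F] {f : α → F} : eLpNorm f 2 μ ^ 2 = ∫⁻ x, ‖f x‖ₑ ^ 2 ∂μ := by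
  rw [eLpNorm_eq_lintegral_rpow_enorm_toReal two_ne_zero ENNReal.ofNat_ne_top,
    ← ENNReal.rpow_natCast, ← ENNReal.rpow_mul]
  simp

/-- The `L²` norm of a difference of translates is controlled by the gradient. -/
theorem IsTestFunction.lintegral_translate_sub_le {φ : EuclideanSpace ℝ (Fin N) → ℝ}
    (hφ : IsTestFunction U φ) (e : EuclideanSpace ℝ (Fin N)) :
    ∫⁻ x, ‖φ x - φ (x + e)‖ₑ ^ 2 ≤ ‖e‖ₑ ^ 2 * ∫⁻ x, ‖gradient φ x‖ₑ ^ 2 := by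
  have hgc := hφ.continuous_gradient
  set ν : Measure ℝ := volume.restrict (Ioc 0 1) with hν
  have : IsProbabilityMeasure ν := ⟨by simp [hν]⟩
  -- The difference is the integral of the directional derivative along the segment from `x` to `x +
  -- e`. After Tonelli, translation invariance removes the dependence on `t`.
  have hpt : ∀ x, ‖φ x - φ (x + e)‖ₑ ^ 2 ≤ ∫⁻ t, ‖⟪gradient φ (x + t • e), e⟫‖ₑ ^ 2 ∂ν := by
    intro x
    have hd : ∀ t : ℝ, HasDerivAt (fun t : ℝ => φ (x + t • e)) ⟪gradient φ (x + t • e), e⟫ t := by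
      intro t
      have h1 : HasDerivAt (fun t : ℝ => x + t • e) e t := by
        simpa using ((hasDerivAt_id t).smul_const e).const_add x
      have h2 := (hφ.differentiable (x + t • e)).hasFDerivAt.comp_hasDerivAt t h1
      rwa [inner_gradient_left]
    have hc : Continuous fun t : ℝ => ⟪gradient φ (x + t • e), e⟫ :=
      (hgc.comp (by fun_prop)).inner continuous_const
    have hftc : ∫ t in (0 : ℝ)..1, ⟪gradient φ (x + t • e), e⟫ = φ (x + e) - φ x := by
      rw [intervalIntegral.integral_eq_sub_of_hasDerivAt (fun t _ => hd t)
        (hc.intervalIntegrable _ _)]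
      simp
    rw [intervalIntegral.integral_of_le zero_le_one] at hftc
    rw [← neg_sub (φ (x + e)), enorm_neg, ← hftc]
    refine (pow_le_pow_left₀ zero_le (enorm_integral_le_lintegral_enorm _) 2).trans ?_
    exact sq_lintegral_enorm_le hc.aestronglyMeasurable
  calc ∫⁻ x, ‖φ x - φ (x + e)‖ₑ ^ 2
      ≤ ∫⁻ x, ∫⁻ t, ‖⟪gradient φ (x + t • e), e⟫‖ₑ ^ 2 ∂ν := lintegral_mono hpt
    _ ≤ ∫⁻ x, ∫⁻ t, ‖e‖ₑ ^ 2 * ‖gradient φ (x + t • e)‖ₑ ^ 2 ∂ν := by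
        refine lintegral_mono fun x => lintegral_mono fun t => ?_
        rw [← mul_pow, mul_comm]
        gcongr
        rw [← enorm_norm (gradient φ _), ← enorm_norm e, ← enorm_mul]
        rw [enorm_le_iff_norm_le, norm_mul, norm_norm, norm_norm]
        exact norm_inner_le_norm _ _
    _ = ∫⁻ t, ∫⁻ x, ‖e‖ₑ ^ 2 * ‖gradient φ (x + t • e)‖ₑ ^ 2 ∂volume ∂ν := by
        refine lintegral_lintegral_swap ?_
        have : Continuous fun p : EuclideanSpace ℝ (Fin N) × ℝ => gradient φ (p.1 + p.2 • e) :=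
          hgc.comp (by fun_prop)
        exact ((this.enorm.measurable.pow_const 2).const_mul _).aemeasurable
    _ = ∫⁻ t, ‖e‖ₑ ^ 2 * ∫⁻ x, ‖gradient φ x‖ₑ ^ 2 ∂volume ∂ν := by
        refine lintegral_congr fun t => ?_
        rw [lintegral_const_mul _ (by
          exact (hgc.comp (continuous_add_const _)).enorm.measurable.pow_const 2)]
        rw [lintegral_add_right_eq_self (fun x => ‖gradient φ x‖ₑ ^ 2)]
    _ = _ := by simp

/-- The normalized Lebesgue measure on a ball around the origin. -/
def ballMeasure (N : ℕ) (δ : ℝ) : Measure (EuclideanSpace ℝ (Fin N)) :=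
  (volume (Metric.ball (0 : EuclideanSpace ℝ (Fin N)) δ))⁻¹ •
    volume.restrict (Metric.ball (0 : EuclideanSpace ℝ (Fin N)) δ)

theorem isProbabilityMeasure_ballMeasure {δ : ℝ} (hδ : 0 < δ) :
    IsProbabilityMeasure (ballMeasure N δ) := ⟨by
  rw [ballMeasure, Measure.smul_apply, Measure.restrict_apply_univ, smul_eq_mul]
  exact ENNReal.inv_mul_cancel (Metric.measure_ball_pos _ _ hδ).ne' measure_ball_lt_top.ne⟩

/-- The ball averages of a test function approximate it in `L²` at a rate controlled by the
gradient. -/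
theorem IsTestFunction.eLpNorm_sub_average_le {φ : EuclideanSpace ℝ (Fin N) → ℝ}
    (hφ : IsTestFunction U φ) {δ : ℝ} (hδ : 0 < δ) :
    eLpNorm (fun x => φ x - ∫ e, φ (x + e) ∂(ballMeasure N δ)) 2 volume ≤
      ENNReal.ofReal δ * eLpNorm (gradient φ) 2 volume := by
  have := isProbabilityMeasure_ballMeasure (N := N) hδ
  rw [← ENNReal.pow_le_pow_left_iff two_ne_zero, mul_pow, eLpNorm_two_sq, eLpNorm_two_sq]
  obtain ⟨B, hB0, hB⟩ := hφ.exists_bound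
  have hc2 : Continuous fun p : EuclideanSpace ℝ (Fin N) × EuclideanSpace ℝ (Fin N) =>
      φ p.1 - φ (p.1 + p.2) :=
    (hφ.continuous.comp continuous_fst).sub (hφ.continuous.comp (by fun_prop))
  have hi : ∀ x, Integrable (fun e => φ (x + e)) (ballMeasure N δ) := fun x =>
    Integrable.of_bound (C := B) (hφ.continuous.comp (by fun_prop)).aestronglyMeasurable
      (Eventually.of_forall fun e => hB _)
  have hpt : ∀ x, ‖φ x - ∫ e, φ (x + e) ∂(ballMeasure N δ)‖ₑ ^ 2 ≤
      ∫⁻ e, ‖φ x - φ (x + e)‖ₑ ^ 2 ∂(ballMeasure N δ) := by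
    intro x
    have h1 : φ x - ∫ e, φ (x + e) ∂(ballMeasure N δ) =
        ∫ e, (φ x - φ (x + e)) ∂(ballMeasure N δ) := by
      rw [integral_sub (integrable_const _) (hi x)]
      simp
    rw [h1]
    refine (pow_le_pow_left₀ zero_le (enorm_integral_le_lintegral_enorm _) 2).trans ?_
    exact sq_lintegral_enorm_le (hc2.comp (by fun_prop : Continuous fun e => (x, e))).aestronglyMeasurable
  calc ∫⁻ x, ‖φ x - ∫ e, φ (x + e) ∂(ballMeasure N δ)‖ₑ ^ 2
      ≤ ∫⁻ x, ∫⁻ e, ‖φ x - φ (x + e)‖ₑ ^ 2 ∂(ballMeasure N δ) := lintegral_mono hpt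
    _ = ∫⁻ e, ∫⁻ x, ‖φ x - φ (x + e)‖ₑ ^ 2 ∂volume ∂(ballMeasure N δ) :=
        lintegral_lintegral_swap (hc2.enorm.measurable.pow_const 2).aemeasurable
    _ ≤ ∫⁻ _, ENNReal.ofReal δ ^ 2 * ∫⁻ x, ‖gradient φ x‖ₑ ^ 2 ∂volume ∂(ballMeasure N δ) := by
        refine lintegral_mono_ae ?_
        have hae : ∀ᵐ e ∂(ballMeasure N δ), e ∈ Metric.ball (0 : EuclideanSpace ℝ (Fin N)) δ :=
          Measure.ae_smul_measure (ae_restrict_mem Metric.isOpen_ball.measurableSet) _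
        filter_upwards [hae] with e he
        refine (hφ.lintegral_translate_sub_le e).trans ?_
        gcongr
        rw [← ofReal_norm]
        exact ENNReal.ofReal_le_ofReal (mem_ball_zero_iff.1 he).le
    _ = _ := by simp

/-- Bounded sequences in a separable Hilbert space have weakly convergent subsequences. -/
theorem exists_subseq_tendsto_inner {H : Type*} [NormedAddCommGroup H] [InnerProductSpace ℝ H]
    [CompleteSpace H] [TopologicalSpace.SeparableSpace H] {R : ℝ} {s : ℕ → H}
    (hs : ∀ n, ‖s n‖ ≤ R) : ∃ ns : ℕ → ℕ, StrictMono ns ∧ ∃ a : H, ∀ f : H,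
      Tendsto (fun n => ⟪s (ns n), f⟫) atTop (𝓝 ⟪a, f⟫) := by
  obtain ⟨l, -, ns, hns, hl⟩ := WeakDual.isSeqCompact_closedBall ℝ H 0 R
    (x := fun n => StrongDual.toWeakDual (InnerProductSpace.toDual ℝ H (s n)))
    (fun n => by simpa using hs n)
  refine ⟨ns, hns, (InnerProductSpace.toDual ℝ H).symm (WeakDual.toStrongDual l), fun f => ?_⟩
  rw [InnerProductSpace.toDual_symm_apply]
  exact ((WeakDual.eval_continuous f).tendsto l).comp hl

/-- Written as an inner product with an indicator function, the average at a fixed point converges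
along weakly convergent sequences. -/
theorem average_eq_inner {φ : EuclideanSpace ℝ (Fin N) → ℝ} (hφ : MemLp φ 2 volume)
    (δ : ℝ) (x : EuclideanSpace ℝ (Fin N)) :
    ∫ e, φ (x + e) ∂(ballMeasure N δ) =
      ((volume (Metric.ball (0 : EuclideanSpace ℝ (Fin N)) δ))⁻¹).toReal *
        ⟪hφ.toLp φ, indicatorConstLp 2 (Metric.isOpen_ball (x := x) (ε := δ)).measurableSet
          measure_ball_lt_top.ne (1 : ℝ)⟫ := by
  rw [real_inner_comm, L2.inner_indicatorConstLp_one, ballMeasure, integral_smul_measure, smul_eq_mul]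
  congr 1
  rw [setIntegral_congr_ae Metric.isOpen_ball.measurableSet
    (hφ.coeFn_toLp.mono fun y hy _ => hy)]
  rw [← (measurePreserving_add_left volume x).setIntegral_preimage_emb
    (measurableEmbedding_addLeft x) φ (Metric.ball x δ)]
  congr 2
  ext e
  simp

/-- **Rellich's theorem** for test functions. -/
theorem exists_subseq_cauchy_of_test (hU : Bornology.IsBounded U) {A R : ℝ}
    {φ : ℕ → EuclideanSpace ℝ (Fin N) → ℝ} (hφ : ∀ n, IsTestFunction U (φ n))
    (hA : ∀ n, eLpNorm (φ n) 2 volume ≤ ENNReal.ofReal A)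
    (hR0 : 0 ≤ R) (hR : ∀ n, eLpNorm (gradient (φ n)) 2 volume ≤ ENNReal.ofReal R) :
    ∃ ns : ℕ → ℕ, StrictMono ns ∧ ∀ ε : ℝ, 0 < ε → ∃ n₀, ∀ n ≥ n₀, ∀ k ≥ n₀,
      eLpNorm (fun x => φ (ns n) x - φ (ns k) x) 2 (volume.restrict U) ≤ ENNReal.ofReal ε := by
  have hmem : ∀ n, MemLp (φ n) 2 volume := fun n => by simpa using (hφ n).memLp 2 univ
  have : IsFiniteMeasure (volume.restrict U) := ⟨by
    rw [Measure.restrict_apply_univ]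
    exact hU.measure_lt_top⟩
  have hnorm : ∀ n, ‖(hmem n).toLp (φ n)‖ ≤ |A| := fun n => by
    rw [Lp.norm_toLp]
    refine (ENNReal.toReal_mono ENNReal.ofReal_ne_top (hA n)).trans ?_
    rw [ENNReal.toReal_ofReal']
    exact max_le (le_abs_self _) (abs_nonneg _)
  have : Fact ((2 : ℝ≥0∞) ≠ ⊤) := ⟨ENNReal.ofNat_ne_top⟩
  -- The subsequence is fixed before `ε` and the radius `δ`, so no diagonal argument is needed.
  obtain ⟨ns, hns, a, ha⟩ := exists_subseq_tendsto_inner hnorm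
  refine ⟨ns, hns, fun ε hε => ?_⟩
  -- Replacing a function by its averages costs at most `δ R ≤ ε/4`. Another `ε/4` goes to the
  -- convergence of the averages, which makes `ε/2` for each of the two indices.
  set δ : ℝ := ε / (4 * (R + 1)) with hδdef
  have hδ : 0 < δ := by positivity
  have hprob := isProbabilityMeasure_ballMeasure (N := N) hδ
  set c := ((volume (Metric.ball (0 : EuclideanSpace ℝ (Fin N)) δ))⁻¹).toReal with hc
  have hc0 : 0 ≤ c := ENNReal.toReal_nonneg
  set b : EuclideanSpace ℝ (Fin N) → Lp ℝ 2 (volume : Measure (EuclideanSpace ℝ (Fin N))) :=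
    fun x => indicatorConstLp 2 (Metric.isOpen_ball (x := x) (ε := δ)).measurableSet
          measure_ball_lt_top.ne (1 : ℝ) with hb
  set M : ℕ → EuclideanSpace ℝ (Fin N) → ℝ := fun n x => ∫ e, φ (ns n) (x + e) ∂(ballMeasure N δ)
    with hM
  have hMb : ∀ n x, M n x = c * ⟪(hmem (ns n)).toLp (φ (ns n)), b x⟫ := fun n x =>
    average_eq_inner (hmem (ns n)) δ x
  set M' : EuclideanSpace ℝ (Fin N) → ℝ := fun x => c * ⟪a, b x⟫ with hM'
  have hlim : ∀ x, Tendsto (fun n => M n x) atTop (𝓝 (M' x)) := fun x => by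
    simp only [hMb]
    exact (ha (b x)).const_mul c
  have hMm : ∀ n, StronglyMeasurable (M n) := fun n => by
    refine StronglyMeasurable.integral_prod_right (f := fun x e => φ (ns n) (x + e)) ?_
    exact ((hφ (ns n)).continuous.comp
      (by fun_prop : Continuous fun p : EuclideanSpace ℝ (Fin N) × EuclideanSpace ℝ (Fin N) =>
        p.1 + p.2)).stronglyMeasurable
  have hM'm : StronglyMeasurable M' :=
    stronglyMeasurable_of_tendsto atTop hMm (tendsto_pi_nhds.2 hlim)
  have hbn : ∀ x, ‖b x‖ = ‖b 0‖ := fun x => by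
    simp only [hb]
    rw [norm_indicatorConstLp two_ne_zero ENNReal.ofNat_ne_top,
      norm_indicatorConstLp two_ne_zero ENNReal.ofNat_ne_top]
    simp only [Measure.real, Measure.addHaar_ball_center]
  have hMbd : ∀ n x, |M n x| ≤ c * (|A| * ‖b 0‖) := fun n x => by
    rw [hMb, abs_mul, abs_of_nonneg hc0]
    gcongr
    refine (abs_real_inner_le_norm _ _).trans ?_
    rw [hbn x]
    gcongr
    exact hnorm _
  -- At fixed `δ` the averages converge pointwise and are uniformly bounded, so dominated
  -- convergence applies on the finite measure space `U`.
  have hconv : Tendsto (fun n => eLpNorm (fun x => M n x - M' x) 2 (volume.restrict U)) atTop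
      (𝓝 0) := by
    refine tendsto_eLpNorm_two_zero_of_dominated (b := fun _ => 2 * (c * (|A| * ‖b 0‖)))
      (fun n => ((hMm n).sub hM'm).aestronglyMeasurable) (memLp_const _)
      (fun n => Eventually.of_forall fun x => ?_) (Eventually.of_forall fun x => ?_)
    · have h1 : |M' x| ≤ c * (|A| * ‖b 0‖) :=
        le_of_tendsto (hlim x).abs (Eventually.of_forall fun n => hMbd n x)
      rw [Real.norm_eq_abs]
      exact (abs_sub _ _).trans (by linarith [hMbd n x])
    · simpa using (hlim x).sub_const (M' x)
  have hδR : ∀ n, eLpNorm (fun x => φ (ns n) x - M n x) 2 (volume.restrict U) ≤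
      ENNReal.ofReal (ε / 4) := fun n => by
    refine (eLpNorm_mono_measure _ Measure.restrict_le_self).trans ?_
    refine ((hφ (ns n)).eLpNorm_sub_average_le hδ).trans ?_
    refine (mul_le_mul_right (hR (ns n)) _).trans ?_
    rw [← ENNReal.ofReal_mul hδ.le]
    apply ENNReal.ofReal_le_ofReal
    calc δ * R ≤ δ * (R + 1) := by gcongr; linarith
      _ = ε / 4 := by rw [hδdef]; field_simp
  obtain ⟨n₀, hn₀⟩ := eventually_atTop.1 (hconv.eventually
    (ge_mem_nhds (ENNReal.ofReal_pos.2 (by positivity : 0 < ε / 4))))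
  have hhalf : ∀ n ≥ n₀, eLpNorm (fun x => φ (ns n) x - M' x) 2 (volume.restrict U) ≤
      ENNReal.ofReal (ε / 2) := fun n hn => by
    have m1 : AEStronglyMeasurable (fun x => φ (ns n) x - M n x) (volume.restrict U) :=
      (hφ (ns n)).continuous.aestronglyMeasurable.sub (hMm n).aestronglyMeasurable
    have m2 : AEStronglyMeasurable (fun x => M n x - M' x) (volume.restrict U) :=
      ((hMm n).sub hM'm).aestronglyMeasurable
    have e : (fun x => φ (ns n) x - M' x) =
      (fun x => φ (ns n) x - M n x) + fun x => M n x - M' x := by ext x; simp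
    rw [e]
    refine (eLpNorm_add_le m1 m2 one_le_two).trans ((add_le_add (hδR n) (hn₀ n hn)).trans ?_)
    rw [← ENNReal.ofReal_add (by positivity) (by positivity)]
    exact ENNReal.ofReal_le_ofReal (by linarith)
  refine ⟨n₀, fun n hn k hk => ?_⟩
  have m1 : ∀ n, AEStronglyMeasurable (fun x => φ (ns n) x - M' x) (volume.restrict U) :=
    fun n => (hφ (ns n)).continuous.aestronglyMeasurable.sub hM'm.aestronglyMeasurable
  have e : (fun x => φ (ns n) x - φ (ns k) x) =
    (fun x => φ (ns n) x - M' x) - fun x => φ (ns k) x - M' x := by ext x; simp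
  rw [e]
  refine (eLpNorm_sub_le (m1 n) (m1 k) one_le_two).trans
    ((add_le_add (hhalf n hn) (hhalf k hk)).trans ?_)
  rw [← ENNReal.ofReal_add (by positivity) (by positivity)]
  exact ENNReal.ofReal_le_ofReal (by linarith)

/-! ### Dirichlet eigenvalues and the Rayleigh quotient -/

/-- `H¹₀(U)` as a subspace of pairs (function, weak gradient). -/
def sobolevSubmodule (U : Set (EuclideanSpace ℝ (Fin N))) :
    Submodule ℝ (Lp ℝ 2 (volume.restrict U) × Lp (EuclideanSpace ℝ (Fin N)) 2 (volume.restrict U))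
    where
  carrier := {p | MemH10 U p.1 p.2}
  zero_mem' := by
    refine (MemH10.of_isTestFunction IsTestFunction.zero).congr ?_ ?_
    · filter_upwards [Lp.coeFn_zero ℝ 2 (volume.restrict U)] with x hx
      exact hx.symm
    · filter_upwards [Lp.coeFn_zero (EuclideanSpace ℝ (Fin N)) 2 (volume.restrict U)] with x hx
      rw [gradient_fun_const]
      exact hx.symm
  add_mem' := by
    intro p q hp hq
    refine (MemH10.add_const_mul hp 1 hq).congr ?_ ?_
    · filter_upwards [Lp.coeFn_add p.1 q.1] with x hx
      rw [one_mul]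
      exact hx.symm
    · filter_upwards [Lp.coeFn_add p.2 q.2] with x hx
      rw [one_smul]
      exact hx.symm
  smul_mem' := by
    intro c p hp
    refine (MemH10.add_const_mul (MemH10.of_isTestFunction IsTestFunction.zero) c hp).congr ?_ ?_
    · filter_upwards [Lp.coeFn_smul c p.1] with x hx
      simp [hx]
    · filter_upwards [Lp.coeFn_smul c p.2] with x hx
      simp [hx, gradient_fun_const]

theorem mem_sobolevSubmodule
    {p : Lp ℝ 2 (volume.restrict U) × Lp (EuclideanSpace ℝ (Fin N)) 2 (volume.restrict U)} :
    p ∈ sobolevSubmodule U ↔ MemH10 U p.1 p.2 := Iff.rfl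

theorem tendsto_eLpNorm_sub_of_tendsto {α F : Type*} {m : MeasurableSpace α} {μ : Measure α}
    [NormedAddCommGroup F] {s : ℕ → Lp F 2 μ} {a : Lp F 2 μ} (h : Tendsto s atTop (𝓝 a)) :
    Tendsto (fun n => eLpNorm (fun x => a x - s n x) 2 μ) atTop (𝓝 0) := by
  refine ((Lp.tendsto_Lp_iff_tendsto_eLpNorm' _ _).1 h).congr fun n => ?_
  exact eLpNorm_sub_comm _ _ _ _

theorem isClosed_sobolevSubmodule (U : Set (EuclideanSpace ℝ (Fin N))) :
    IsClosed (sobolevSubmodule U : Set (Lp ℝ 2 (volume.restrict U) ×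
      Lp (EuclideanSpace ℝ (Fin N)) 2 (volume.restrict U))) := by
  refine IsSeqClosed.isClosed fun s p hs hp => ?_
  exact MemH10.of_tendsto (fun n => hs n) (Lp.aestronglyMeasurable _) (Lp.aestronglyMeasurable _)
    (tendsto_eLpNorm_sub_of_tendsto ((continuous_fst.tendsto p).comp hp))
    (tendsto_eLpNorm_sub_of_tendsto ((continuous_snd.tendsto p).comp hp))

/-- **Rellich's theorem** for `H¹₀` of a bounded set. -/
theorem exists_subseq_cauchy_of_mem_sobolevSubmodule (hU : Bornology.IsBounded U) {R : ℝ}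
    {s : ℕ → Lp ℝ 2 (volume.restrict U) × Lp (EuclideanSpace ℝ (Fin N)) 2 (volume.restrict U)}
    (hs : ∀ n, s n ∈ sobolevSubmodule U) (h1 : ∀ n, ‖(s n).1‖ ≤ 1) (hR : ∀ n, ‖(s n).2‖ ≤ R) :
    ∃ ns : ℕ → ℕ, StrictMono ns ∧ CauchySeq fun n => (s (ns n)).1 := by
  have hpos : ∀ n : ℕ, (0 : ℝ) < 1 / ((n : ℝ) + 1) := fun n => by positivity
  have hle1 : ∀ n : ℕ, 1 / ((n : ℝ) + 1) ≤ 1 := fun n => by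
    rw [div_le_one (by positivity)]
    linarith [n.cast_nonneg (α := ℝ)]
  -- Test functions at distance `1/(n+1)` reduce the claim to the previous form of Rellich's
  -- theorem; the norm bounds grow by at most `1`, to `2` and `R + 1`.
  choose φ hφ a1 a2 using fun n : ℕ =>
    (mem_sobolevSubmodule.1 (hs n)).approx (ENNReal.ofReal (1 / ((n : ℝ) + 1)))
      (ENNReal.ofReal_pos.2 (hpos n))
  have hR0 : 0 ≤ R := (norm_nonneg _).trans (hR 0)
  have hA : ∀ n, eLpNorm (φ n) 2 volume ≤ ENNReal.ofReal 2 := fun n => by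
    rw [← eLpNorm_restrict_eq_of_support_subset
      ((subset_tsupport _).trans (hφ n).support)]
    have e : φ n = ⇑(s n).1 - fun x => (s n).1 x - φ n x := by ext x; simp
    rw [e]
    refine (eLpNorm_sub_le (Lp.aestronglyMeasurable _)
      ((Lp.aestronglyMeasurable _).sub ((hφ n).memLp 2 U).1) one_le_two).trans ?_
    rw [show (2 : ℝ) = 1 + 1 by norm_num, ENNReal.ofReal_add zero_le_one zero_le_one]
    refine add_le_add ?_ ((a1 n).trans (ENNReal.ofReal_le_ofReal (hle1 n)))
    rw [← Lp.enorm_def, ← ofReal_norm]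
    exact ENNReal.ofReal_le_ofReal (h1 n)
  have hG : ∀ n, eLpNorm (gradient (φ n)) 2 volume ≤ ENNReal.ofReal (R + 1) := fun n => by
    rw [← eLpNorm_restrict_eq_of_support_subset (s := U) (fun x hx => by
      by_contra h
      exact hx ((hφ n).gradient_eq_zero h))]
    have e : gradient (φ n) = ⇑(s n).2 - fun x => (s n).2 x - gradient (φ n) x := by
      ext x : 1; simp
    rw [e]
    refine (eLpNorm_sub_le (Lp.aestronglyMeasurable _)
      ((Lp.aestronglyMeasurable _).sub ((hφ n).memLp_gradient 2 U).1) one_le_two).trans ?_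
    rw [ENNReal.ofReal_add hR0 zero_le_one]
    refine add_le_add ?_ ((a2 n).trans (ENNReal.ofReal_le_ofReal (hle1 n)))
    rw [← Lp.enorm_def, ← ofReal_norm]
    exact ENNReal.ofReal_le_ofReal (hR n)
  obtain ⟨ns, hns, hC⟩ := exists_subseq_cauchy_of_test hU hφ hA (by positivity) hG
  refine ⟨ns, hns, EMetric.cauchySeq_iff.2 fun ε hε => ?_⟩
  -- The factor `3` counts two approximation errors and the distance between the test functions.
  obtain ⟨η, hη, hηε⟩ : ∃ η : ℝ, 0 < η ∧ ENNReal.ofReal (3 * η) < ε := by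
    obtain ⟨r, hr0, hr⟩ := ENNReal.lt_iff_exists_real_btwn.1 hε
    refine ⟨r / 3, ?_, ?_⟩
    · have := ENNReal.ofReal_pos.1 hr.1
      positivity
    · convert hr.2 using 2
      ring
  obtain ⟨n₀, hn₀⟩ := hC η hη
  have ht : Tendsto (fun n => 1 / ((ns n : ℝ) + 1)) atTop (𝓝 0) :=
    tendsto_one_div_add_atTop_nhds_zero_nat.comp hns.tendsto_atTop
  obtain ⟨n₁, hn₁⟩ := eventually_atTop.1 (ht.eventually (ge_mem_nhds hη))
  refine ⟨max n₀ n₁, fun n hn k hk => ?_⟩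
  rw [edist_comm, Lp.edist_def]
  refine lt_of_le_of_lt ?_ hηε
  have m1 : ∀ n, AEStronglyMeasurable (fun x => (s n).1 x - φ n x) (volume.restrict U) :=
    fun n => (Lp.aestronglyMeasurable _).sub ((hφ n).memLp 2 U).1
  have m2 : AEStronglyMeasurable (fun x => φ (ns k) x - φ (ns n) x) (volume.restrict U) :=
    ((hφ (ns k)).memLp 2 U).1.sub ((hφ (ns n)).memLp 2 U).1
  have e : ⇑(s (ns k)).1 - ⇑(s (ns n)).1 = ((fun x => (s (ns k)).1 x - φ (ns k) x) +
      fun x => φ (ns k) x - φ (ns n) x) - fun x => (s (ns n)).1 x - φ (ns n) x := by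
    ext x; simp
  rw [e]
  refine (eLpNorm_sub_le ((m1 _).add m2) (m1 _) one_le_two).trans ?_
  refine (add_le_add ((eLpNorm_add_le (m1 _) m2 one_le_two).trans (add_le_add ((a1 _).trans
    (ENNReal.ofReal_le_ofReal (hn₁ k ((le_max_right _ _).trans hk))))
    (hn₀ k ((le_max_left _ _).trans hk) n ((le_max_left _ _).trans hn)))) ((a1 _).trans
    (ENNReal.ofReal_le_ofReal (hn₁ n ((le_max_right _ _).trans hn))))).trans ?_
  rw [← ENNReal.ofReal_add hη.le hη.le, ← ENNReal.ofReal_add (by positivity) hη.le]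
  exact ENNReal.ofReal_le_ofReal (by linarith)

theorem MemH10.toLp_mem {u : EuclideanSpace ℝ (Fin N) → ℝ}
    {g : EuclideanSpace ℝ (Fin N) → EuclideanSpace ℝ (Fin N)} (hu : MemH10 U u g) :
    (hu.memLp_fun.toLp u, hu.memLp_grad.toLp g) ∈ sobolevSubmodule U :=
  hu.congr (hu.memLp_fun.coeFn_toLp.mono fun _ h => h.symm)
    (hu.memLp_grad.coeFn_toLp.mono fun _ h => h.symm)

/-- On a bounded set carrying a nonzero element of `H¹₀`, some Dirichlet eigenvalue bounds the
Rayleigh quotient from below. -/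
theorem exists_eigenvalue_le_rayleigh (hU : Bornology.IsBounded U)
    {u : EuclideanSpace ℝ (Fin N) → ℝ}
    {g : EuclideanSpace ℝ (Fin N) → EuclideanSpace ℝ (Fin N)} (hu : MemH10 U u g)
    (h0 : ¬ ∀ᵐ x ∂(volume.restrict U), u x = 0) :
    ∃ m, IsDirichletEigenvalue U m ∧
      m * ∫ x in U, u x * u x ≤ ∫ x in U, ⟪g x, g x⟫ := by
  obtain ⟨m, v, hv, hv0, hEL, hmin⟩ := exists_minimal_rayleigh (sobolevSubmodule U)
    (isClosed_sobolevSubmodule U)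
    (fun R s hs h1 hR => exists_subseq_cauchy_of_mem_sobolevSubmodule hU hs h1 hR)
    ⟨_, hu.toLp_mem, fun h => h0 (by
      have h1 := hu.memLp_fun.coeFn_toLp
      rw [show hu.memLp_fun.toLp u = 0 from h] at h1
      filter_upwards [h1, Lp.coeFn_zero ℝ 2 (volume.restrict U)] with x hx hx0
      rw [← hx, hx0]
      rfl)⟩
  refine ⟨m, ⟨v.1, v.2, hv, fun h => hv0 (Lp.eq_zero_iff_ae_eq_zero.2 h), fun w h hw => ?_⟩, ?_⟩
  · have := hEL _ hw.toLp_mem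
    rw [L2.inner_def, L2.inner_def] at this
    convert this using 1
    · refine integral_congr_ae ?_
      filter_upwards [hw.memLp_grad.coeFn_toLp] with x hx
      simp only [hx]
    · congr 1
      refine integral_congr_ae ?_
      filter_upwards [hw.memLp_fun.coeFn_toLp] with x hx
      simp only [hx]
      simp [mul_comm]
  · have := hmin _ hu.toLp_mem
    rw [← real_inner_self_eq_norm_sq, ← real_inner_self_eq_norm_sq, L2.inner_def,
      L2.inner_def] at this
    convert this using 1
    · congr 1
      refine integral_congr_ae ?_
      filter_upwards [hu.memLp_fun.coeFn_toLp] with x hx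
      simp only [hx]
      simp [sq]
    · refine integral_congr_ae ?_
      filter_upwards [hu.memLp_grad.coeFn_toLp] with x hx
      simp only [hx]

/-- Test the eigenfunction with itself. This keeps the infimum over all eigenvalues away from `-∞`.
-/
theorem IsDirichletEigenvalue.nonneg {μ : ℝ} (h : IsDirichletEigenvalue U μ) : 0 ≤ μ := by
  obtain ⟨v, g, hv, h0, H⟩ := h
  have h1 := H v g hv
  have h2 : 0 ≤ ∫ x in U, ⟪g x, g x⟫ := integral_nonneg fun x => real_inner_self_nonneg
  have h3 : 0 < ∫ x in U, v x * v x := by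
    refine lt_of_le_of_ne (integral_nonneg fun x => mul_self_nonneg _) fun h => h0 ?_
    have hi : Integrable (fun x => v x * v x) (volume.restrict U) := by
      simpa [sq] using hv.memLp_fun.integrable_sq
    filter_upwards [(integral_eq_zero_iff_of_nonneg (fun x => mul_self_nonneg _) hi).1 h.symm]
      with x hx
    exact mul_self_eq_zero.1 hx
  rw [h1] at h2
  exact nonneg_of_mul_nonneg_left h2 h3

theorem integrable_inner_of_memLp {α : Type*} {m : MeasurableSpace α} {μ : Measure α}
    {F : Type*} [NormedAddCommGroup F] [InnerProductSpace ℝ F] {f g : α → F} (hf : MemLp f 2 μ)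
    (hg : MemLp g 2 μ) : Integrable (fun x => ⟪f x, g x⟫) μ :=
  (hf.norm.integrable_mul hg.norm).mono' (hf.1.inner hg.1)
    (Eventually.of_forall fun x => norm_inner_le_norm (f x) (g x))

/-! ### Interior continuity through radial averages -/

/-- A radial bump supported in the unit ball. -/
def radialBump (y : EuclideanSpace ℝ (Fin N)) : ℝ := Real.smoothTransition (1 - ‖y‖ ^ 2)

/-- The averaging kernel with `∇ radialBump y = -radialKernel y • y`. -/
def radialKernel (y : EuclideanSpace ℝ (Fin N)) : ℝ :=
  2 * deriv Real.smoothTransition (1 - ‖y‖ ^ 2)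

theorem contDiff_smoothTransition : ContDiff ℝ ∞ Real.smoothTransition :=
  Real.smoothTransition.contDiff (n := ⊤)

theorem contDiff_radialBump : ContDiff ℝ ∞ (radialBump (N := N)) :=
  contDiff_smoothTransition.comp (contDiff_const.sub (contDiff_norm_sq ℝ))

theorem continuous_radialKernel : Continuous (radialKernel (N := N)) :=
  continuous_const.mul ((contDiff_smoothTransition.continuous_deriv (by simp)).comp
    (by fun_prop))

theorem one_sub_sq_nonpos {t : ℝ} (ht : 1 ≤ t) : 1 - t ^ 2 ≤ 0 := by nlinarith

theorem radialBump_eq_zero {y : EuclideanSpace ℝ (Fin N)} (hy : 1 ≤ ‖y‖) : radialBump y = 0 :=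
  Real.smoothTransition.zero_of_nonpos (one_sub_sq_nonpos hy)

theorem radialKernel_eq_zero {y : EuclideanSpace ℝ (Fin N)} (hy : 1 ≤ ‖y‖) :
    radialKernel y = 0 := by
  -- On and outside the unit sphere the argument is a global minimum point of the transition
  -- function, so the derivative vanishes there, including at the endpoint `0`.
  have h : IsLocalMin Real.smoothTransition (1 - ‖y‖ ^ 2) := Eventually.of_forall fun t => by
    rw [Real.smoothTransition.zero_of_nonpos (one_sub_sq_nonpos hy)]
    exact Real.smoothTransition.nonneg t
  rw [radialKernel, h.deriv_eq_zero, mul_zero]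

theorem hasCompactSupport_radialKernel : HasCompactSupport (radialKernel (N := N)) :=
  HasCompactSupport.of_support_subset_isCompact (isCompact_closedBall 0 1) fun y hy => by
    by_contra h
    exact hy (radialKernel_eq_zero (by simpa using (not_le.1 (mt mem_closedBall_zero_iff.2 h)).le))

theorem radialBump_nonneg (y : EuclideanSpace ℝ (Fin N)) : 0 ≤ radialBump y :=
  Real.smoothTransition.nonneg _

theorem radialKernel_nonneg (y : EuclideanSpace ℝ (Fin N)) : 0 ≤ radialKernel y :=
  mul_nonneg zero_le_two Real.smoothTransition.monotone.deriv_nonneg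

theorem gradient_radialBump (y : EuclideanSpace ℝ (Fin N)) :
    gradient radialBump y = -(radialKernel y • y) := by
  have h1 : HasFDerivAt (fun y : EuclideanSpace ℝ (Fin N) => 1 - ‖y‖ ^ 2)
      (-(2 • innerSL ℝ y)) y := by
    simpa using (hasStrictFDerivAt_norm_sq y).hasFDerivAt.const_sub 1
  have h2 := ((contDiff_smoothTransition.differentiable (by simp))
    (1 - ‖y‖ ^ 2)).hasDerivAt.comp_hasFDerivAt y h1
  refine HasGradientAt.gradient ?_
  rw [hasGradientAt_iff_hasFDerivAt]
  refine h2.congr_fderiv ?_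
  ext z
  simp [radialKernel]
  ring

theorem exists_bound_radialKernel : ∃ B, 0 ≤ B ∧ ∀ y : EuclideanSpace ℝ (Fin N),
    |radialKernel y| ≤ B := by
  obtain ⟨B, hB⟩ := continuous_radialKernel.bounded_above_of_compact_support
    (hasCompactSupport_radialKernel (N := N))
  exact ⟨B, (norm_nonneg _).trans (hB 0), hB⟩

theorem integral_radialKernel_pos (hN : 1 ≤ N) :
    0 < ∫ y : EuclideanSpace ℝ (Fin N), radialKernel y := by
  -- The mean value theorem gives a point `c` where the transition has slope `1`. A vector of length
  -- `√(1 - c)`, which exists because `N ≥ 1`, makes the kernel nonzero.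
  obtain ⟨c, hc, hd⟩ := exists_deriv_eq_slope Real.smoothTransition zero_lt_one
    contDiff_smoothTransition.continuous.continuousOn
    (contDiff_smoothTransition.differentiable (by simp)).differentiableOn
  refine continuous_radialKernel.integral_pos_of_hasCompactSupport_nonneg_nonzero
    hasCompactSupport_radialKernel radialKernel_nonneg
    (x := EuclideanSpace.single (⟨0, hN⟩ : Fin N) (Real.sqrt (1 - c))) ?_
  rw [radialKernel, PiLp.norm_single, Real.norm_eq_abs, sq_abs,
    Real.sq_sqrt (by linarith [hc.2]), sub_sub_cancel, hd]
  simp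

theorem integral_comp_rescale {F : Type*} [NormedAddCommGroup F] [NormedSpace ℝ F]
    (w : EuclideanSpace ℝ (Fin N) → F) (x : EuclideanSpace ℝ (Fin N)) {ρ : ℝ} (hρ : 0 < ρ) :
    ∫ z, w (ρ⁻¹ • (z - x)) = ρ ^ N • ∫ y, w y := by
  rw [integral_sub_right_eq_self (fun z => w (ρ⁻¹ • z)) x,
    Measure.integral_comp_inv_smul_of_nonneg volume w hρ.le]
  simp

/-- Weighted average of `w` around `x` at scale `ρ`, up to the normalization of the kernel. -/
def radialAverage (w : EuclideanSpace ℝ (Fin N) → ℝ) (x : EuclideanSpace ℝ (Fin N)) (ρ : ℝ) : ℝ :=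
  (ρ ^ N)⁻¹ * ∫ z, w z * radialKernel (ρ⁻¹ • (z - x))

theorem rescale_cancel {x y : EuclideanSpace ℝ (Fin N)} {ρ : ℝ} (hρ : 0 < ρ) :
    x + ρ • (ρ⁻¹ • (y - x)) = y := by
  rw [smul_smul, mul_inv_cancel₀ hρ.ne', one_smul, add_sub_cancel]

theorem radialAverage_eq (w : EuclideanSpace ℝ (Fin N) → ℝ) (x : EuclideanSpace ℝ (Fin N))
    {ρ : ℝ} (hρ : 0 < ρ) : radialAverage w x ρ = ∫ y, w (x + ρ • y) * radialKernel y := by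
  have h := integral_comp_rescale (fun y => w (x + ρ • y) * radialKernel y) x hρ
  simp only [rescale_cancel hρ, smul_eq_mul] at h
  rw [radialAverage, h, inv_mul_cancel_left₀ (by positivity)]

/-- The bump at scale `s` around `x` is a test function of an open set containing the closed
ball. -/
theorem isTestFunction_radialBump {x : EuclideanSpace ℝ (Fin N)} {s : ℝ} (hs : 0 < s)
    (hsub : Metric.closedBall x s ⊆ Ω) :
    IsTestFunction Ω (fun z => radialBump (s⁻¹ • (z - x))) := by
  have hsupp : Function.support (fun z => radialBump (s⁻¹ • (z - x))) ⊆ Metric.closedBall x s := by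
    intro z hz
    by_contra h
    refine hz (radialBump_eq_zero ?_)
    rw [norm_smul, norm_inv, Real.norm_eq_abs, abs_of_pos hs, ← dist_eq_norm]
    rw [Metric.mem_closedBall, not_le] at h
    rw [inv_mul_eq_div, one_le_div hs]
    exact h.le
  exact ⟨contDiff_radialBump.comp (by fun_prop),
    HasCompactSupport.of_support_subset_isCompact (isCompact_closedBall x s) hsupp,
    (closure_minimal hsupp Metric.isClosed_closedBall).trans hsub⟩

theorem gradient_radialBump_rescale (x z : EuclideanSpace ℝ (Fin N)) (s : ℝ) :
    gradient (fun z => radialBump (s⁻¹ • (z - x))) z =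
      -(s⁻¹ • radialKernel (s⁻¹ • (z - x)) • (s⁻¹ • (z - x))) := by
  have h1 : HasFDerivAt (fun z : EuclideanSpace ℝ (Fin N) => s⁻¹ • (z - x))
      (s⁻¹ • ContinuousLinearMap.id ℝ (EuclideanSpace ℝ (Fin N))) z :=
    ((hasFDerivAt_id z).sub_const x).const_smul s⁻¹
  have hd : DifferentiableAt ℝ radialBump (s⁻¹ • (z - x)) :=
    contDiff_radialBump.differentiable (by simp) _
  have h2 := hd.hasFDerivAt.comp z h1
  refine HasGradientAt.gradient ?_
  rw [hasGradientAt_iff_hasFDerivAt]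
  refine h2.congr_fderiv ?_
  rw [← toDual_gradient, gradient_radialBump]
  ext w
  simp only [ContinuousLinearMap.comp_apply, _root_.smul_apply,
    ContinuousLinearMap.id_apply, InnerProductSpace.toDual_apply_apply, inner_neg_left,
    inner_smul_left, inner_smul_right]
  simp

/-- The averages of a test function are differentiable in the scale. -/
theorem IsTestFunction.hasDerivAt_radialAverage {φ : EuclideanSpace ℝ (Fin N) → ℝ}
    (hφ : IsTestFunction U φ) (x : EuclideanSpace ℝ (Fin N)) (s : ℝ) :
    HasDerivAt (fun s => ∫ y, φ (x + s • y) * radialKernel y)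
      (∫ y, ⟪gradient φ (x + s • y), y⟫ * radialKernel y) s := by
  obtain ⟨D, hD0, hD⟩ := hφ.exists_bound_gradient
  have hc : ∀ s : ℝ, Continuous fun y => φ (x + s • y) * radialKernel y := fun s =>
    (hφ.continuous.comp (by fun_prop)).mul continuous_radialKernel
  have hc' : ∀ s : ℝ, Continuous fun y => ⟪gradient φ (x + s • y), y⟫ * radialKernel y := fun s =>
    ((hφ.continuous_gradient.comp (by fun_prop)).inner continuous_id).mul continuous_radialKernel
  refine (hasDerivAt_integral_of_dominated_loc_of_deriv_le (s := univ)
    (F' := fun s y => ⟪gradient φ (x + s • y), y⟫ * radialKernel y)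
    (bound := fun y => D * ‖y‖ * |radialKernel y|) univ_mem
    (Eventually.of_forall fun s => (hc s).aestronglyMeasurable)
    ((hc s).integrable_of_hasCompactSupport hasCompactSupport_radialKernel.mul_left)
    (hc' s).aestronglyMeasurable (Eventually.of_forall fun y t _ => ?_) ?_
    (Eventually.of_forall fun y t _ => ?_)).2
  · rw [norm_mul, Real.norm_eq_abs, Real.norm_eq_abs]
    gcongr
    refine (abs_real_inner_le_norm _ _).trans ?_
    gcongr
    exact hD _
  · exact ((continuous_const.mul continuous_norm).mul
      continuous_radialKernel.abs).integrable_of_hasCompactSupport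
        hasCompactSupport_radialKernel.abs.mul_left
  · have h1 : HasDerivAt (fun t : ℝ => x + t • y) y t := by
      simpa using ((hasDerivAt_id t).smul_const y).const_add x
    have h2 := (hφ.differentiable (x + t • y)).hasFDerivAt.comp_hasDerivAt t h1
    rw [← inner_gradient_left] at h2
    exact h2.mul_const _

/-- Since `radialKernel y • y` is minus the gradient of the bump, a change of variables turns the
scale derivative of the average into a Dirichlet pairing with a test function. This is the form in
which the weak equation can be used. -/
theorem IsTestFunction.integral_inner_mul_radialKernel {φ : EuclideanSpace ℝ (Fin N) → ℝ}
    (hφ : IsTestFunction Ω φ) (x : EuclideanSpace ℝ (Fin N)) {s : ℝ} (hs : 0 < s) :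
    ∫ y, ⟪gradient φ (x + s • y), y⟫ * radialKernel y =
      -(s * (s ^ N)⁻¹ *
        ∫ z in Ω, ⟪gradient φ z, gradient (fun z => radialBump (s⁻¹ • (z - x))) z⟫) := by
  rw [setIntegral_eq fun z hz => by rw [hφ.gradient_eq_zero hz, inner_zero_left]]
  have h := integral_comp_rescale
    (fun y => ⟪gradient φ (x + s • y), y⟫ * radialKernel y) x hs
  simp only [rescale_cancel hs, smul_eq_mul] at h
  rw [← inv_mul_cancel_left₀ (pow_pos hs N).ne'
    (∫ y, ⟪gradient φ (x + s • y), y⟫ * radialKernel y), ← h, mul_assoc, mul_left_comm,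
    ← mul_neg]
  congr 1
  rw [← integral_const_mul, ← integral_neg]
  congr 1
  ext z
  rw [gradient_radialBump_rescale, inner_neg_right]
  generalize radialKernel (s⁻¹ • (z - x)) = k
  simp only [inner_smul_right]
  field_simp

/-- Averages at different scales of a weak solution with bounded right-hand side. -/
theorem MemH10.abs_radialAverage_sub_le {u h : EuclideanSpace ℝ (Fin N) → ℝ}
    {g : EuclideanSpace ℝ (Fin N) → EuclideanSpace ℝ (Fin N)} (hΩm : MeasurableSet Ω)
    (hΩb : Bornology.IsBounded Ω)
    (hu : MemH10 Ω u g) {M : ℝ} (hM : ∀ᵐ x ∂(volume.restrict Ω), |h x| ≤ M)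
    (hsol : ∀ φ, IsTestFunction Ω φ → ∫ x in Ω, ⟪g x, gradient φ x⟫ = ∫ x in Ω, h x * φ x)
    {x : EuclideanSpace ℝ (Fin N)} {s t : ℝ} (hs : 0 < s) (hst : s ≤ t)
    (hsub : Metric.closedBall x t ⊆ Ω) :
    |radialAverage (Ω.indicator u) x t - radialAverage (Ω.indicator u) x s| ≤
      M * (∫ y : EuclideanSpace ℝ (Fin N), radialBump y) * t * (t - s) := by
  have hfin : IsFiniteMeasure (volume.restrict Ω) := ⟨by
    rw [Measure.restrict_apply_univ]
    exact hΩb.measure_lt_top⟩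
  obtain ⟨φ, hφ, a1, a2, -⟩ := hu.exists_seq
  obtain ⟨B, hB0, hB⟩ := exists_bound_radialKernel (N := N)
  set κ := ∫ y : EuclideanSpace ℝ (Fin N), radialBump y with hκ
  have hκ0 : 0 ≤ κ := integral_nonneg radialBump_nonneg
  -- convergence in `L¹`
  have hL1 : ∀ {F : Type} [NormedAddCommGroup F] {w : EuclideanSpace ℝ (Fin N) → F}
      {w' : ℕ → EuclideanSpace ℝ (Fin N) → F}, MemLp w 2 (volume.restrict Ω) →
      (∀ n, MemLp (w' n) 2 (volume.restrict Ω)) →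
      Tendsto (fun n => eLpNorm (fun x => w x - w' n x) 2 (volume.restrict Ω)) atTop (𝓝 0) →
      Tendsto (fun n => ∫ x in Ω, ‖w x - w' n x‖) atTop (𝓝 0) := by
    intro F _ w w' hw hw' hl
    have h1 : Tendsto (fun n => eLpNorm (fun x => w x - w' n x) 1 (volume.restrict Ω)) atTop
        (𝓝 0) := by
      have hz := ENNReal.Tendsto.mul_const (b := (volume.restrict Ω) univ ^
        (1 / (1 : ℝ≥0∞).toReal - 1 / (2 : ℝ≥0∞).toReal)) hl (Or.inr (by
          refine ENNReal.rpow_ne_top_of_nonneg (by norm_num) (measure_ne_top _ _)))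
      rw [zero_mul] at hz
      exact tendsto_of_tendsto_of_tendsto_of_le_of_le tendsto_const_nhds hz (fun _ => zero_le)
        fun n => eLpNorm_le_eLpNorm_mul_rpow_measure_univ one_le_two (hw.1.sub (hw' n).1)
    have h2 := (ENNReal.tendsto_toReal ENNReal.zero_ne_top).comp h1
    refine h2.congr fun n => ?_
    rw [Function.comp_apply, eLpNorm_one_eq_lintegral_enorm,
      integral_norm_eq_lintegral_enorm (f := fun x => w x - w' n x) (hw.1.sub (hw' n).1)]
  have e1 := hL1 hu.memLp_fun (fun n => (hφ n).memLp 2 Ω) a1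
  have e2 := hL1 hu.memLp_grad (fun n => (hφ n).memLp_gradient 2 Ω) a2
  have mi : ∀ {w : EuclideanSpace ℝ (Fin N) → ℝ}, MemLp w 2 (volume.restrict Ω) →
      Integrable w (volume.restrict Ω) := fun hw => hw.integrable one_le_two
  have mig : ∀ n, Integrable (fun z => g z - gradient (φ n) z) (volume.restrict Ω) := fun n =>
    (hu.memLp_grad.sub ((hφ n).memLp_gradient 2 Ω)).integrable one_le_two
  -- the averages converge
  have hav : ∀ r, Tendsto (fun n => radialAverage (φ n) x r) atTop
      (𝓝 (radialAverage (Ω.indicator u) x r)) := by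
    intro r
    refine Tendsto.const_mul _ ?_
    have hk : Continuous fun z => radialKernel (r⁻¹ • (z - x)) :=
      continuous_radialKernel.comp (by fun_prop)
    have hprod : ∀ {w : EuclideanSpace ℝ (Fin N) → ℝ}, MemLp w 2 (volume.restrict Ω) →
        Integrable (fun z => w z * radialKernel (r⁻¹ • (z - x))) (volume.restrict Ω) := fun hw =>
      (mi hw).mul_bdd (c := B) hk.aestronglyMeasurable (Eventually.of_forall fun z => hB _)
    have hset : ∀ {w : EuclideanSpace ℝ (Fin N) → ℝ}, (∀ z ∉ Ω, w z = 0) →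
        ∫ z, w z * radialKernel (r⁻¹ • (z - x)) =
          ∫ z in Ω, w z * radialKernel (r⁻¹ • (z - x)) := fun hw =>
      (IsTestFunction.setIntegral_eq fun z hz => by rw [hw z hz, zero_mul]).symm
    rw [hset fun z hz => indicator_of_notMem hz u,
      setIntegral_congr_fun (g := fun z => u z * radialKernel (r⁻¹ • (z - x))) hΩm
        fun z hz => by simp only [indicator_of_mem hz]]
    simp_rw [fun n => hset fun z hz => (hφ n).eq_zero hz]
    rw [tendsto_iff_norm_sub_tendsto_zero]
    refine squeeze_zero (fun _ => norm_nonneg _) (fun n => ?_) (by simpa using e1.const_mul B)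
    rw [norm_sub_rev, ← integral_sub (hprod hu.memLp_fun) (hprod ((hφ n).memLp 2 Ω)),
      ← integral_const_mul]
    refine norm_integral_le_of_norm_le
      ((mi (hu.memLp_fun.sub ((hφ n).memLp 2 Ω))).norm.const_mul B)
      (Eventually.of_forall fun z => ?_)
    rw [← sub_mul, norm_mul, mul_comm]
    exact mul_le_mul_of_nonneg_right (hB _) (norm_nonneg _)
  -- the scale derivative
  set C : ℕ → ℝ := fun n => M * κ * t + (s ^ N)⁻¹ * (B * ∫ z in Ω, ‖g z - gradient (φ n) z‖)
    with hC
  -- Replace `∇φₙ` by `g` in the pairing. The equation bounds the main part by `M κ r^N`; after the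
  -- factor `r · r^(-N)` this is `M κ r ≤ M κ t`. The replacement error tends to zero as `n → ∞`,
  -- uniformly for `r ≥ s`.
  have hder : ∀ n, ∀ r ∈ Icc s t,
      ‖∫ y, ⟪gradient (φ n) (x + r • y), y⟫ * radialKernel y‖ ≤ C n := by
    intro n r hr
    have hr0 : 0 < r := hs.trans_le hr.1
    -- The bound by `M` holds only almost everywhere, so `0 ≤ M` requires `Ω` to have positive
    -- measure; the ball inside `Ω` provides this.
    have hM0 : 0 ≤ M ∨ volume Ω = 0 := by
      by_cases hz : volume Ω = 0
      · exact Or.inr hz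
      · left
        have : (ae (volume.restrict Ω)).NeBot := ae_neBot.2 (by simpa using hz)
        obtain ⟨z, hz⟩ := hM.exists
        exact (abs_nonneg _).trans hz
    have hMt : 0 ≤ M := hM0.resolve_right fun hz => by
      have : Metric.ball x t ⊆ Ω := Metric.ball_subset_closedBall.trans hsub
      exact (Metric.measure_ball_pos volume x (hs.trans_le hst)).ne' (measure_mono_null this hz)
    have hψ := isTestFunction_radialBump (Ω := Ω) hr0
      ((Metric.closedBall_subset_closedBall hr.2).trans hsub)
    set ψ := fun z => radialBump (r⁻¹ • (z - x)) with hψdef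
    have hgψ : ∀ z, ‖gradient ψ z‖ ≤ r⁻¹ * B := fun z => by
      rw [hψdef, gradient_radialBump_rescale, norm_neg, norm_smul, norm_smul, norm_inv,
        Real.norm_eq_abs, abs_of_pos hr0]
      gcongr
      rcases le_or_gt 1 ‖r⁻¹ • (z - x)‖ with h1 | h1
      · simp [radialKernel_eq_zero h1, hB0]
      · calc _ ≤ B * 1 := mul_le_mul (hB _) h1.le (norm_nonneg _) hB0
          _ = B := mul_one B
    have i1 : Integrable (fun z => ⟪g z, gradient ψ z⟫) (volume.restrict Ω) :=
      integrable_inner_of_memLp hu.memLp_grad (hψ.memLp_gradient 2 Ω)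
    have i2 : Integrable (fun z => ⟪gradient (φ n) z, gradient ψ z⟫) (volume.restrict Ω) :=
      integrable_inner_of_memLp ((hφ n).memLp_gradient 2 Ω) (hψ.memLp_gradient 2 Ω)
    have b1 : |∫ z in Ω, ⟪g z, gradient ψ z⟫| ≤ M * (r ^ N * κ) := by
      rw [hsol ψ hψ, ← smul_eq_mul (r ^ N), hκ, ← integral_comp_rescale radialBump x hr0,
        ← IsTestFunction.setIntegral_eq (U := Ω) fun z hz => hψ.eq_zero hz, ← integral_const_mul,
        ← Real.norm_eq_abs]
      refine norm_integral_le_of_norm_le ((mi (hψ.memLp 2 Ω)).const_mul M) ?_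
      filter_upwards [hM] with z hz
      rw [norm_mul, Real.norm_eq_abs, Real.norm_of_nonneg (radialBump_nonneg _)]
      exact mul_le_mul_of_nonneg_right hz (radialBump_nonneg _)
    have b2 : |(∫ z in Ω, ⟪g z, gradient ψ z⟫) - ∫ z in Ω, ⟪gradient (φ n) z, gradient ψ z⟫| ≤
        (r⁻¹ * B) * ∫ z in Ω, ‖g z - gradient (φ n) z‖ := by
      rw [← integral_sub i1 i2, ← integral_const_mul, ← Real.norm_eq_abs]
      refine norm_integral_le_of_norm_le ((mig n).norm.const_mul _)
        (Eventually.of_forall fun z => ?_)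
      rw [← inner_sub_left, mul_comm]
      refine (norm_inner_le_norm _ _).trans ?_
      gcongr
      exact hgψ z
    have hI0 : 0 ≤ ∫ z in Ω, ‖g z - gradient (φ n) z‖ := integral_nonneg fun z => norm_nonneg _
    rw [(hφ n).integral_inner_mul_radialKernel x hr0, norm_neg, norm_mul,
      Real.norm_of_nonneg (by positivity : 0 ≤ r * (r ^ N)⁻¹), Real.norm_eq_abs]
    have b3 : |∫ z in Ω, ⟪gradient (φ n) z, gradient ψ z⟫| ≤
        M * (r ^ N * κ) + (r⁻¹ * B) * ∫ z in Ω, ‖g z - gradient (φ n) z‖ := by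
      have := abs_sub_abs_le_abs_sub (∫ z in Ω, ⟪gradient (φ n) z, gradient ψ z⟫)
        (∫ z in Ω, ⟪g z, gradient ψ z⟫)
      rw [abs_sub_comm] at this
      linarith
    calc _ ≤ r * (r ^ N)⁻¹ *
          (M * (r ^ N * κ) + (r⁻¹ * B) * ∫ z in Ω, ‖g z - gradient (φ n) z‖) := by gcongr
      _ = M * κ * r + (r ^ N)⁻¹ * (B * ∫ z in Ω, ‖g z - gradient (φ n) z‖) := by
          field_simp
      _ ≤ C n := by
          change _ ≤ M * κ * t + (s ^ N)⁻¹ * (B * ∫ z in Ω, ‖g z - gradient (φ n) z‖)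
          gcongr
          · exact hr.2
          · exact hr.1
  have hmv : ∀ n, |radialAverage (φ n) x t - radialAverage (φ n) x s| ≤ C n * (t - s) := by
    intro n
    have := (convex_Icc s t).norm_image_sub_le_of_norm_hasDerivWithin_le
      (fun r _ => ((hφ n).hasDerivAt_radialAverage x r).hasDerivWithinAt) (hder n)
      (left_mem_Icc.2 hst) (right_mem_Icc.2 hst)
    rw [radialAverage_eq _ _ hs, radialAverage_eq _ _ (hs.trans_le hst)]
    rwa [Real.norm_eq_abs, Real.norm_eq_abs, abs_of_nonneg (sub_nonneg.2 hst)] at this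
  have hClim : Tendsto (fun n => C n * (t - s)) atTop (𝓝 (M * κ * t * (t - s))) := by
    have : Tendsto C atTop (𝓝 (M * κ * t + (s ^ N)⁻¹ * (B * 0))) :=
      ((e2.const_mul B).const_mul _).const_add _
    simpa using this.mul_const (t - s)
  exact le_of_tendsto_of_tendsto ((hav t).sub (hav s)).abs hClim (Eventually.of_forall hmv)

theorem continuous_radialAverage {w : EuclideanSpace ℝ (Fin N) → ℝ} (hw : Integrable w)
    (ρ : ℝ) : Continuous fun x => radialAverage w x ρ := by
  obtain ⟨B, hB0, hB⟩ := exists_bound_radialKernel (N := N)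
  refine continuous_const.mul (continuous_of_dominated (bound := fun z => ‖w z‖ * B) (fun x => ?_)
    (fun x => Eventually.of_forall fun z => ?_) (hw.norm.mul_const B)
    (Eventually.of_forall fun z => ?_))
  · exact hw.1.mul (continuous_radialKernel.comp (by fun_prop)).aestronglyMeasurable
  · rw [norm_mul]
    exact mul_le_mul_of_nonneg_left (hB _) (norm_nonneg _)
  · exact continuous_const.mul (continuous_radialKernel.comp (by fun_prop))

/-- Almost everywhere convergence of the averages. -/
theorem ae_tendsto_radialAverage {w : EuclideanSpace ℝ (Fin N) → ℝ} (hw : Integrable w)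
    {ρ : ℕ → ℝ} (hρ : ∀ n, 0 < ρ n) (hρ0 : Tendsto ρ atTop (𝓝 0)) :
    ∀ᵐ x, Tendsto (fun n => radialAverage w x (ρ n)) atTop
      (𝓝 ((∫ y : EuclideanSpace ℝ (Fin N), radialKernel y) * w x)) := by
  obtain ⟨B, hB0, hB⟩ := exists_bound_radialKernel (N := N)
  -- At a Lebesgue point the kernel, bounded by `B` and supported in the ball of radius `ρ n`, gives
  -- an error of at most `B v` times the mean oscillation of `w` on that ball.
  filter_upwards [IsUnifLocDoublingMeasure.ae_tendsto_average_norm_sub (μ := volume)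
    hw.locallyIntegrable 1] with x hx
  have hlim := hx (fun _ : ℕ => x) ρ (tendsto_nhdsWithin_iff.2
    ⟨hρ0, Eventually.of_forall hρ⟩) (Eventually.of_forall fun n => by simpa using (hρ n).le)
  set v := volume.real (Metric.closedBall (0 : EuclideanSpace ℝ (Fin N)) 1) with hv
  have hv0 : 0 < v := ENNReal.toReal_pos
    (Metric.measure_closedBall_pos volume _ zero_lt_one).ne' measure_closedBall_lt_top.ne
  rw [tendsto_iff_norm_sub_tendsto_zero]
  refine squeeze_zero (fun _ => norm_nonneg _) (fun n => ?_)
    (by have := hlim.const_mul (B * v); rwa [mul_zero] at this)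
  have hr := hρ n
  have hk : Continuous fun z => radialKernel ((ρ n)⁻¹ • (z - x)) :=
    continuous_radialKernel.comp (by fun_prop)
  have hzero : ∀ z ∉ Metric.closedBall x (ρ n), radialKernel ((ρ n)⁻¹ • (z - x)) = 0 := by
    intro z hz
    refine radialKernel_eq_zero ?_
    rw [norm_smul, norm_inv, Real.norm_eq_abs, abs_of_pos hr, ← dist_eq_norm]
    rw [Metric.mem_closedBall, not_le] at hz
    rw [inv_mul_eq_div, one_le_div hr]
    exact hz.le
  have hcs : HasCompactSupport fun z => radialKernel ((ρ n)⁻¹ • (z - x)) :=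
    HasCompactSupport.of_support_subset_isCompact (isCompact_closedBall x (ρ n)) fun z hz => by
      by_contra h
      exact hz (hzero z h)
  have hkint : Integrable fun z => radialKernel ((ρ n)⁻¹ • (z - x)) :=
    hk.integrable_of_hasCompactSupport hcs
  have hwk : Integrable fun z => w z * radialKernel ((ρ n)⁻¹ • (z - x)) :=
    hw.mul_bdd (c := B) hk.aestronglyMeasurable (Eventually.of_forall fun z => hB _)
  have h1 : (∫ y : EuclideanSpace ℝ (Fin N), radialKernel y) * w x =
      ((ρ n) ^ N)⁻¹ * ∫ z, w x * radialKernel ((ρ n)⁻¹ • (z - x)) := by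
    rw [integral_const_mul, integral_comp_rescale radialKernel x hr, smul_eq_mul]
    field_simp
  have hav : ⨍ y in Metric.closedBall x (ρ n), ‖w y - w x‖ =
      ((ρ n) ^ N * v)⁻¹ * ∫ y in Metric.closedBall x (ρ n), ‖w y - w x‖ := by
    rw [setAverage_eq, smul_eq_mul, Measure.addHaar_real_closedBall' volume x hr.le]
    simp [hv]
  rw [h1, radialAverage, ← mul_sub, ← integral_sub hwk (hkint.const_mul _), hav, norm_mul,
    Real.norm_of_nonneg (by positivity : 0 ≤ ((ρ n) ^ N)⁻¹)]
  have hint : IntegrableOn (fun y => ‖w y - w x‖) (Metric.closedBall x (ρ n)) :=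
    (hw.integrableOn.sub (integrableOn_const measure_closedBall_lt_top.ne)).norm
  have h2 : ‖∫ z, (w z * radialKernel ((ρ n)⁻¹ • (z - x)) -
      w x * radialKernel ((ρ n)⁻¹ • (z - x)))‖ ≤
      B * ∫ y in Metric.closedBall x (ρ n), ‖w y - w x‖ := by
    rw [← IsTestFunction.setIntegral_eq (U := Metric.closedBall x (ρ n)) fun z hz => by
      rw [hzero z hz]; ring, ← integral_const_mul]
    refine norm_integral_le_of_norm_le (hint.const_mul B) (Eventually.of_forall fun z => ?_)
    rw [← sub_mul, norm_mul, mul_comm]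
    exact mul_le_mul_of_nonneg_right (hB _) (norm_nonneg _)
  calc _ ≤ ((ρ n) ^ N)⁻¹ * (B * ∫ y in Metric.closedBall x (ρ n), ‖w y - w x‖) := by gcongr
    _ = _ := by field_simp

/-- A weak solution of `-Δu = h` with bounded `h` has a continuous representative. -/
theorem MemH10.exists_continuousOn_ae_eq (hN : 1 ≤ N) {u h : EuclideanSpace ℝ (Fin N) → ℝ}
    {g : EuclideanSpace ℝ (Fin N) → EuclideanSpace ℝ (Fin N)} (hΩ : IsOpen Ω)
    (hΩb : Bornology.IsBounded Ω)
    (hu : MemH10 Ω u g) {M : ℝ} (hM : ∀ᵐ x ∂(volume.restrict Ω), |h x| ≤ M)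
    (hsol : ∀ φ, IsTestFunction Ω φ → ∫ x in Ω, ⟪g x, gradient φ x⟫ = ∫ x in Ω, h x * φ x) :
    ∃ v, ContinuousOn v Ω ∧ ∀ᵐ x ∂(volume.restrict Ω), u x = v x := by
  have hfin : IsFiniteMeasure (volume.restrict Ω) := ⟨by
    rw [Measure.restrict_apply_univ]
    exact hΩb.measure_lt_top⟩
  have hw : Integrable (Ω.indicator u) :=
    (integrable_indicator_iff hΩ.measurableSet).2 (hu.memLp_fun.integrable one_le_two)
  set A := radialAverage (Ω.indicator u) with hA
  set κ := ∫ y : EuclideanSpace ℝ (Fin N), radialBump y with hκ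
  set c := ∫ y : EuclideanSpace ℝ (Fin N), radialKernel y with hc
  have hc0 : 0 < c := integral_radialKernel_pos hN
  set ρ : ℕ → ℝ := fun n => 1 / ((n : ℝ) + 1) with hρdef
  have hρ : ∀ n, 0 < ρ n := fun n => by positivity
  have hρ0 : Tendsto ρ atTop (𝓝 0) := tendsto_one_div_add_atTop_nhds_zero_nat
  have hρanti : Antitone ρ := fun m n hmn => one_div_le_one_div_of_le (by positivity)
    (by simpa using hmn)
  -- Taking `|M * κ|` makes the bound monotone in the scales without discussing the sign of `M`.
  have hest : ∀ x n k, n ≤ k → Metric.closedBall x (ρ n) ⊆ Ω →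
      |A x (ρ n) - A x (ρ k)| ≤ |M * κ| * ρ n * ρ n := by
    intro x n k hnk hsub
    refine (hu.abs_radialAverage_sub_le hΩ.measurableSet hΩb hM hsol (hρ k) (hρanti hnk)
      hsub).trans ?_
    have h1 : ρ n - ρ k ≤ ρ n := by linarith [hρ k]
    have h2 : 0 ≤ ρ n - ρ k := sub_nonneg.2 (hρanti hnk)
    have := hρ n
    gcongr
    exact le_abs_self _
  have hsq : Tendsto (fun n => |M * κ| * ρ n * ρ n) atTop (𝓝 0) := by
    simpa using (hρ0.const_mul |M * κ|).mul hρ0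
  have hball : ∀ x ∈ Ω, ∃ δ > 0, ∃ n₀, ∀ y ∈ Metric.ball x δ, ∀ n ≥ n₀,
      Metric.closedBall y (ρ n) ⊆ Ω := by
    intro x hx
    obtain ⟨δ, hδ, hsub⟩ := Metric.isOpen_iff.1 hΩ x hx
    obtain ⟨n₀, hn₀⟩ := eventually_atTop.1 (hρ0.eventually (gt_mem_nhds (half_pos hδ)))
    refine ⟨δ / 2, half_pos hδ, n₀, fun y hy n hn z hz => hsub ?_⟩
    rw [Metric.mem_ball] at hy ⊢
    rw [Metric.mem_closedBall] at hz
    linarith [dist_triangle z y x, hn₀ n hn]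
  have hcauchy : ∀ x ∈ Ω, CauchySeq fun n => A x (ρ n) := by
    intro x hx
    obtain ⟨δ, hδ, n₀, hn₀⟩ := hball x hx
    rw [Metric.cauchySeq_iff']
    intro ε hε
    obtain ⟨n₁, hn₁⟩ := eventually_atTop.1 (hsq.eventually (gt_mem_nhds hε))
    refine ⟨max n₀ n₁, fun n hn => ?_⟩
    rw [dist_comm, Real.dist_eq]
    exact (hest x _ n hn (hn₀ x (Metric.mem_ball_self hδ) _ (le_max_left _ _))).trans_lt
      (hn₁ _ (le_max_right _ _))
  have hex : ∀ x, ∃ a, x ∈ Ω → Tendsto (fun n => A x (ρ n)) atTop (𝓝 a) := fun x => by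
    by_cases hx : x ∈ Ω
    · obtain ⟨a, ha⟩ := cauchySeq_tendsto_of_complete (hcauchy x hx)
      exact ⟨a, fun _ => ha⟩
    · exact ⟨0, fun h => absurd h hx⟩
  choose L hL using hex
  -- The Cauchy estimate depends on `x` only through the requirement that the ball lie in `Ω`, which
  -- holds near each point from a common index on.
  have hunif : TendstoLocallyUniformlyOn (fun n x => A x (ρ n)) L atTop Ω := by
    rw [Metric.tendstoLocallyUniformlyOn_iff]
    intro ε hε x hx
    obtain ⟨δ, hδ, n₀, hn₀⟩ := hball x hx
    refine ⟨Metric.ball x δ ∩ Ω, inter_mem (mem_nhdsWithin_of_mem_nhds (Metric.ball_mem_nhds x hδ))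
      self_mem_nhdsWithin, ?_⟩
    filter_upwards [hsq.eventually (gt_mem_nhds hε), eventually_ge_atTop n₀] with n hn hnn y hy
    rw [dist_comm, Real.dist_eq]
    refine lt_of_le_of_lt ?_ hn
    refine le_of_tendsto (tendsto_const_nhds.sub (hL y hy.2)).abs ?_
    filter_upwards [eventually_ge_atTop n] with k hk
    exact hest y n k hk (hn₀ y hy.1 n hnn)
  have hLc : ContinuousOn L Ω := hunif.continuousOn (Frequently.of_forall fun n =>
    (continuous_radialAverage hw (ρ n)).continuousOn)
  refine ⟨fun x => c⁻¹ * L x, continuousOn_const.mul hLc, ?_⟩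
  filter_upwards [ae_restrict_of_ae (ae_tendsto_radialAverage hw hρ hρ0),
    ae_restrict_mem hΩ.measurableSet] with x hx hxΩ
  have := tendsto_nhds_unique (hL x hxΩ) hx
  rw [this, indicator_of_mem hxΩ, ← hc]
  field_simp

/-! ### The possibly negative region and the energy estimates -/

theorem isOpen_possiblyNegativeRegion (hΩ : IsOpen Ω) (uhat : EuclideanSpace ℝ (Fin N) → ℝ)
    (r : ℝ) : IsOpen (possiblyNegativeRegion Ω uhat r) := by
  rw [isOpen_iff_mem_nhds]
  rintro x ⟨hx, W, hW, h0⟩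
  filter_upwards [hΩ.mem_nhds hx, eventually_mem_nhds_iff.2 hW] with y hy hyW
  exact ⟨hy, W, hyW, h0⟩

/-- Where a continuous function is negative, a function within `r` of it is at most `r`. -/
theorem mem_possiblyNegativeRegion (hΩ : IsOpen Ω) {uhat w : EuclideanSpace ℝ (Fin N) → ℝ}
    {r : ℝ} (hw : ContinuousOn w Ω)
    (hr : ∀ᵐ x ∂(volume.restrict Ω), |w x - uhat x| ≤ r) {x : EuclideanSpace ℝ (Fin N)}
    (hx : x ∈ Ω) (hneg : w x < 0) : x ∈ possiblyNegativeRegion Ω uhat r := by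
  -- The neighbourhood is `{w < 0}` itself: a point of it with `û > r` would violate `|w - û| ≤ r`,
  -- so such points form a null set.
  refine ⟨hx, Ω ∩ w ⁻¹' Iio 0, (hw.isOpen_inter_preimage hΩ isOpen_Iio).mem_nhds ⟨hx, hneg⟩, ?_⟩
  rw [ae_restrict_iff' hΩ.measurableSet] at hr
  refine measure_mono_null (fun y hy => ?_) hr
  simp only [mem_compl_iff, mem_ofPred_eq, Classical.not_imp, not_le]
  refine ⟨hy.1.1, ?_⟩
  have h1 : w y < 0 := hy.1.2
  have h2 : uhat y - r > 0 := hy.2.2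
  rw [abs_sub_comm]
  exact lt_of_lt_of_le (by linarith) (le_abs_self _)

theorem ae_abs_le_of_eLpNorm_top_le {α : Type*} {m : MeasurableSpace α} {μ : Measure α}
    {f : α → ℝ} {r : ℝ} (hr : 0 ≤ r) (h : eLpNorm f ∞ μ ≤ ENNReal.ofReal r) :
    ∀ᵐ x ∂μ, |f x| ≤ r := by
  rw [eLpNorm_exponent_top] at h
  filter_upwards [ae_le_eLpNormEssSup (f := f) (μ := μ)] with x hx
  have := hx.trans h
  rwa [← ofReal_norm, ENNReal.ofReal_le_ofReal_iff hr] at this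

theorem integral_rpow_eq_eLpNorm {α : Type*} {m : MeasurableSpace α} {μ : Measure α}
    {v : α → ℝ} {q : ℝ} (hq : 0 < q) (hv : MemLp v (ENNReal.ofReal q) μ) (h0 : ∀ x, 0 ≤ v x) :
    ∫ x, v x ^ q ∂μ = (eLpNorm v (ENNReal.ofReal q) μ).toReal ^ q := by
  have hI : 0 ≤ ∫ x, v x ^ q ∂μ := integral_nonneg fun x => Real.rpow_nonneg (h0 x) _
  rw [hv.eLpNorm_eq_integral_rpow_norm (ENNReal.ofReal_pos.2 hq).ne' ENNReal.ofReal_ne_top,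
    ENNReal.toReal_ofReal hq.le]
  simp_rw [fun x => Real.norm_of_nonneg (h0 x)]
  rw [ENNReal.toReal_ofReal (Real.rpow_nonneg hI _), ← Real.rpow_mul hI,
    inv_mul_cancel₀ hq.ne', Real.rpow_one]

theorem eLpNorm_two_eq_sqrt {α F : Type*} {m : MeasurableSpace α} {μ : Measure α}
    [NormedAddCommGroup F] [InnerProductSpace ℝ F] {h : α → F} (hh : MemLp h 2 μ) :
    eLpNorm h 2 μ = ENNReal.ofReal (Real.sqrt (∫ x, ⟪h x, h x⟫ ∂μ)) := by
  rw [hh.eLpNorm_eq_integral_rpow_norm two_ne_zero ENNReal.ofNat_ne_top, Real.sqrt_eq_rpow]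
  simp

/-- The superlinear terms are absorbed by the Dirichlet integral. -/
theorem integral_rpow_le_of_isEmbeddingBound {q' C b : ℝ} (hq : 1 < q')
    (hC : IsEmbeddingBound Ω (q' + 1) C) {v : EuclideanSpace ℝ (Fin N) → ℝ}
    {h : EuclideanSpace ℝ (Fin N) → EuclideanSpace ℝ (Fin N)} (hv : MemH10 Ω v h)
    (h0 : ∀ x, 0 ≤ v x) (hb : (eLpNorm v (ENNReal.ofReal (q' + 1)) (volume.restrict Ω)).toReal ≤ b) :
    ∫ x in Ω, v x ^ (q' + 1) ≤ C ^ 2 * b ^ (q' - 1) * ∫ x in Ω, ⟪h x, h x⟫ := by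
  have hD0 : 0 ≤ ∫ x in Ω, ⟪h x, h x⟫ := integral_nonneg fun x => real_inner_self_nonneg
  have h1 := hC.2 v h hv
  rw [eLpNorm_two_eq_sqrt hv.memLp_grad, ← ENNReal.ofReal_mul hC.1.le] at h1
  have hmem : MemLp v (ENNReal.ofReal (q' + 1)) (volume.restrict Ω) :=
    ⟨hv.memLp_fun.1, h1.trans_lt ENNReal.ofReal_lt_top⟩
  rw [integral_rpow_eq_eLpNorm (by linarith) hmem h0]
  set n := (eLpNorm v (ENNReal.ofReal (q' + 1)) (volume.restrict Ω)).toReal with hn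
  have hn0 : 0 ≤ n := ENNReal.toReal_nonneg
  have h2 : n ≤ C * Real.sqrt (∫ x in Ω, ⟪h x, h x⟫) := by
    have := ENNReal.toReal_mono ENNReal.ofReal_ne_top h1
    rwa [ENNReal.toReal_ofReal (mul_nonneg hC.1.le (Real.sqrt_nonneg _))] at this
  have h3 : n ^ 2 ≤ C ^ 2 * ∫ x in Ω, ⟪h x, h x⟫ := by
    calc n ^ 2 ≤ (C * Real.sqrt (∫ x in Ω, ⟪h x, h x⟫)) ^ 2 := by gcongr
      _ = _ := by rw [mul_pow, Real.sq_sqrt hD0]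
  -- Two of the `q' + 1` powers are paid for by the Dirichlet integral, the other `q' - 1` by the a
  -- priori bound `b`.
  have h4 : n ^ (q' + 1) = n ^ (q' - 1) * n ^ 2 := by
    rw [← Real.rpow_natCast, ← Real.rpow_add' hn0 (by norm_num; linarith)]
    congr 1
    norm_num
    ring
  rw [h4]
  calc n ^ (q' - 1) * n ^ 2 ≤ b ^ (q' - 1) * (C ^ 2 * ∫ x in Ω, ⟪h x, h x⟫) :=
        mul_le_mul (Real.rpow_le_rpow hn0 hb (by linarith)) h3 (sq_nonneg _)
          (Real.rpow_nonneg (hn0.trans hb) _)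
    _ = _ := by ring

/-- The first eigenvalue is a lower bound of the Rayleigh quotient; in particular it is finite
as soon as there is a nonzero element of `H¹₀`. -/
theorem exists_firstDirichletEigenvalue_eq (hU : Bornology.IsBounded U)
    {v : EuclideanSpace ℝ (Fin N) → ℝ}
    {h : EuclideanSpace ℝ (Fin N) → EuclideanSpace ℝ (Fin N)} (hv : MemH10 U v h)
    (h0 : ¬ ∀ᵐ x ∂(volume.restrict U), v x = 0) :
    ∃ l : ℝ, firstDirichletEigenvalue U = l ∧
      l * ∫ x in U, v x * v x ≤ ∫ x in U, ⟪h x, h x⟫ := by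
  obtain ⟨m, hm, hle⟩ := exists_eigenvalue_le_rayleigh hU hv h0
  have h1 : firstDirichletEigenvalue U ≤ m := sInf_le ⟨m, hm, rfl⟩
  have h2 : ((0 : ℝ) : EReal) ≤ firstDirichletEigenvalue U := by
    refine le_sInf ?_
    rintro _ ⟨μ, hμ, rfl⟩
    exact EReal.coe_le_coe_iff.2 (IsDirichletEigenvalue.nonneg hμ)
  obtain ⟨l, hl⟩ : ∃ l : ℝ, firstDirichletEigenvalue U = l :=
    ⟨(firstDirichletEigenvalue U).toReal, (EReal.coe_toReal
      (ne_top_of_le_ne_top (EReal.coe_ne_top m) h1)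
      (ne_bot_of_le_ne_bot (EReal.coe_ne_bot 0) h2)).symm⟩
  refine ⟨l, hl, le_trans ?_ hle⟩
  rw [hl, EReal.coe_le_coe_iff] at h1
  exact mul_le_mul_of_nonneg_right h1 (integral_nonneg fun x => mul_self_nonneg _)

/-- The energy inequality for the negative part contradicts the spectral gap. -/
theorem false_of_energy_le {D S l lam σ : ℝ} (hD : 0 ≤ D) (hS : 0 < S) (hlS : l * S ≤ D)
    (hlam : lam < l) (hσ : σ < 1 - max lam 0 / l) (hE : D ≤ lam * S + σ * D) : False := by
  -- If `lam ≤ 0`, absorption alone forces `D = 0`, and then `l * S ≤ 0 ≤ lam * S` contradicts `lam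
  -- < l`. If `lam > 0`, then `lam * S ≤ (lam / l) * D` and the total factor of `D` is below `1`.
  rcases le_or_gt lam 0 with h | h
  · rw [max_eq_right h, zero_div, sub_zero] at hσ
    have h1 : lam * S ≤ 0 := mul_nonpos_of_nonpos_of_nonneg h hS.le
    have hD0 : D = 0 := by nlinarith
    rw [hD0] at hlS hE
    have h2 : lam * S < l * S := by gcongr
    linarith
  · have hl : 0 < l := h.trans hlam
    rw [max_eq_left h.le] at hσ
    have h1 : lam * S ≤ lam / l * D := by
      calc lam * S = lam / l * (l * S) := by field_simp
        _ ≤ lam / l * D := by gcongr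
    have h2 : 0 < D := (mul_pos hl hS).trans_le hlS
    nlinarith

end EllipticPositivity

end

/-! ### The positivity theorem -/

open EllipticPositivity in
theorem mainTheorem3
    {N : ℕ} (hN : 1 ≤ N)
    (Ω : Set (EuclideanSpace ℝ (Fin N)))
    (hΩ_open : IsOpen Ω) (hΩ_conn : IsConnected Ω) (hΩ_bdd : Bornology.IsBounded Ω)
    (f : ℝ → ℝ) (hf : EllipticPositivity.AdmissibleNonlinearity N f)
    -- the approximation, in `H¹₀(Ω) ∩ L^∞(Ω)`
    (uhat : EuclideanSpace ℝ (Fin N) → ℝ)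
    (ghat : EuclideanSpace ℝ (Fin N) → EuclideanSpace ℝ (Fin N))
    (huhat : EllipticPositivity.MemH10 Ω uhat ghat)
    (huhat_bdd : MemLp uhat ∞ (volume.restrict Ω))
    -- the verified solution, with its `H¹₀` and `L^∞` error bounds
    (u : EuclideanSpace ℝ (Fin N) → ℝ)
    (g : EuclideanSpace ℝ (Fin N) → EuclideanSpace ℝ (Fin N))
    (hu : EllipticPositivity.IsWeakSolution Ω f u g)
    (ρ : ℝ) (hρ : 0 < ρ)
    (hH10 : eLpNorm (fun x => g x - ghat x) 2 (volume.restrict Ω) ≤ ENNReal.ofReal ρ)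
    (r : ℝ) (hr : 0 < r)
    (hLinf : eLpNorm (fun x => u x - uhat x) ∞ (volume.restrict Ω) ≤ ENNReal.ofReal r)
    -- the one-sided bound for the nonlinearity
    (lam : ℝ)
    (hlam : (lam : EReal) < EllipticPositivity.firstDirichletEigenvalue
      (EllipticPositivity.possiblyNegativeRegion Ω uhat r))
    (n : ℕ) (a p C : Fin n → ℝ)
    (ha : ∀ i, 0 ≤ a i)
    (hp : ∀ i, 1 < p i ∧ EllipticPositivity.Subcritical N (p i))
    (hf_bound : ∀ t : ℝ, 0 ≤ t → -f (-t) ≤ lam * t + ∑ i, a i * t ^ p i)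
    (hC : ∀ i, EllipticPositivity.IsEmbeddingBound Ω (p i + 1) (C i))
    (hcond :
      ((∑ i, a i * C i ^ 2 *
          ((eLpNorm (fun x => max (-uhat x) 0) (ENNReal.ofReal (p i + 1))
              (volume.restrict Ω)).toReal + C i * ρ) ^ (p i - 1) : ℝ) : EReal) <
        1 - ((max lam 0 : ℝ) : EReal) / EllipticPositivity.firstDirichletEigenvalue
          (EllipticPositivity.possiblyNegativeRegion Ω uhat r)) :
    ∀ᵐ x ∂(volume.restrict Ω), 0 ≤ u x := by
  have hfin : IsFiniteMeasure (volume.restrict Ω) := ⟨by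
    rw [Measure.restrict_apply_univ]
    exact hΩ_bdd.measure_lt_top⟩
  have hfc : Continuous f := hf.1.continuous
  have hur := ae_abs_le_of_eLpNorm_top_le hr.le hLinf
  -- boundedness and continuity of the solution
  obtain ⟨K, hK⟩ : ∃ K, ∀ᵐ x ∂(volume.restrict Ω), |u x| ≤ K := by
    have h1 := ae_abs_le_of_eLpNorm_top_le ENNReal.toReal_nonneg
      (ENNReal.ofReal_toReal huhat_bdd.2.ne).ge
    refine ⟨(eLpNorm uhat ∞ (volume.restrict Ω)).toReal + r, ?_⟩
    filter_upwards [h1, hur] with x hx hx'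
    have := abs_sub_abs_le_abs_sub (u x) (uhat x)
    linarith
  obtain ⟨M, hM⟩ := (isCompact_Icc (a := -K) (b := K)).exists_bound_of_continuousOn
    hfc.continuousOn
  obtain ⟨w, hwc, huw⟩ := hu.1.exists_continuousOn_ae_eq hN hΩ_open hΩ_bdd
    (h := fun x => f (u x)) (M := M) (hK.mono fun x hx => hM _ (abs_le.1 hx))
    (fun φ hφ => sub_eq_zero.1 (hu.2 φ _ (MemH10.of_isTestFunction hφ)))
  have hwH : MemH10 Ω w g := hu.1.congr huw (Eventually.of_forall fun _ => rfl)
  have hwK : ∀ᵐ x ∂(volume.restrict Ω), |w x| ≤ K := by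
    filter_upwards [hK, huw] with x hx hx'
    rwa [← hx']
  have hwr : ∀ᵐ x ∂(volume.restrict Ω), |w x - uhat x| ≤ r := by
    filter_upwards [hur, huw] with x hx hx'
    rwa [← hx']
  set U := possiblyNegativeRegion Ω uhat r with hUdef
  have hU : IsOpen U := isOpen_possiblyNegativeRegion hΩ_open uhat r
  have hUΩ : U ⊆ Ω := fun x hx => hx.1
  have hneg : ∀ x ∈ Ω, w x < 0 → x ∈ U := fun x hx h =>
    mem_possiblyNegativeRegion hΩ_open hwc hwr hx h
  -- the negative part
  have hvU := hwH.negPart_of_continuousOn hU hUΩ hwc hwK hneg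
  have hvΩ := hwH.negPart
  set v : EuclideanSpace ℝ (Fin N) → ℝ := fun x => max (-w x) 0 with hv
  set h : EuclideanSpace ℝ (Fin N) → EuclideanSpace ℝ (Fin N) :=
    fun x => (if w x < 0 then (-1 : ℝ) else 0) • g x with hh
  have hv0 : ∀ x, 0 ≤ v x := fun x => le_max_right _ _
  have hout : ∀ x ∈ Ω \ U, 0 ≤ w x := fun x hx => not_lt.1 fun hlt => hx.2 (hneg x hx.1 hlt)
  have hvout : ∀ x ∈ Ω \ U, v x = 0 := fun x hx => max_eq_right (by linarith [hout x hx])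
  have hhout : ∀ x ∈ Ω \ U, h x = 0 := fun x hx => by
    simp only [hh, if_neg (not_lt.2 (hout x hx)), zero_smul]
  by_contra hcon
  -- Vanishing almost everywhere on `U` is enough for the contradiction, because `v` is zero at
  -- every point of `Ω \ U`.
  have hvne : ¬ ∀ᵐ x ∂(volume.restrict U), v x = 0 := by
    intro hz
    refine hcon ?_
    rw [ae_restrict_iff' hU.measurableSet] at hz
    filter_upwards [huw, ae_restrict_mem hΩ_open.measurableSet, ae_restrict_of_ae hz]
      with x hx hxΩ hxz
    rw [hx]
    have hvx : v x = 0 := by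
      by_cases hxU : x ∈ U
      · exact hxz hxU
      · exact hvout x ⟨hxΩ, hxU⟩
    linarith [le_max_left (-w x) 0, (show max (-w x) 0 = 0 from hvx)]
  -- The nonzero `v` in `H¹₀(U)` makes the first eigenvalue a real number, so from here on the
  -- extended real hypotheses become real inequalities.
  obtain ⟨l, hl, hlS⟩ := exists_firstDirichletEigenvalue_eq (hΩ_bdd.subset hUΩ) hvU hvne
  rw [hl] at hlam hcond
  have hSeq : ∫ x in U, v x * v x = ∫ x in Ω, v x * v x :=
    (setIntegral_eq_of_subset_of_forall_sdiff_eq_zero hΩ_open.measurableSet hUΩ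
      fun x hx => by rw [hvout x hx, zero_mul]).symm
  have hDeq : ∫ x in U, ⟪h x, h x⟫ = ∫ x in Ω, ⟪h x, h x⟫ :=
    (setIntegral_eq_of_subset_of_forall_sdiff_eq_zero hΩ_open.measurableSet hUΩ
      fun x hx => by rw [hhout x hx, inner_zero_left]).symm
  rw [hSeq, hDeq] at hlS
  set D := ∫ x in Ω, ⟪h x, h x⟫ with hD
  set S := ∫ x in Ω, v x * v x with hS
  have hvm : AEStronglyMeasurable v (volume.restrict Ω) := hvΩ.memLp_fun.1
  have hvK : ∀ᵐ x ∂(volume.restrict Ω), v x ≤ |K| := by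
    filter_upwards [hwK] with x hx
    exact max_le ((neg_le_abs _).trans (hx.trans (le_abs_self _))) (abs_nonneg _)
  have hvv : Integrable (fun x => v x * v x) (volume.restrict Ω) := by
    simpa [sq] using hvΩ.memLp_fun.integrable_sq
  have hS0 : 0 < S := by
    refine lt_of_le_of_ne (integral_nonneg fun x => mul_self_nonneg _) fun hz => hvne ?_
    refine ae_mono (Measure.restrict_mono_set volume hUΩ) ?_
    filter_upwards [(integral_eq_zero_iff_of_nonneg (fun x => mul_self_nonneg _) hvv).1 hz.symm]
      with x hx
    exact mul_self_eq_zero.1 hx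
  have hpow : ∀ i, Integrable (fun x => v x ^ (p i + 1)) (volume.restrict Ω) := fun i => by
    have hp1 := (hp i).1
    refine Integrable.of_bound (C := |K| ^ (p i + 1))
      ((Real.continuous_rpow_const (by linarith)).comp_aestronglyMeasurable hvm) ?_
    filter_upwards [hvK] with x hx
    rw [Real.norm_of_nonneg (Real.rpow_nonneg (hv0 x) _)]
    exact Real.rpow_le_rpow (hv0 x) hx (by linarith)
  -- testing with the negative part
  have hE : D ≤ lam * S + ∑ i, a i * ∫ x in Ω, v x ^ (p i + 1) := by
    have h1 : D = ∫ x in Ω, -f (-v x) * v x := by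
      have h2 := sub_eq_zero.1 (hu.2 v h hvΩ)
      -- The weak gradient of `v` is `-g` on `{w < 0}` and `0` elsewhere, so `|h|² = -⟪g, h⟫`
      -- pointwise.
      have h3 : D = -∫ x in Ω, ⟪g x, h x⟫ := by
        rw [hD, ← integral_neg]
        congr 1
        ext x
        simp only [hh]
        split_ifs <;> simp
      rw [h3, h2, ← integral_neg]
      refine integral_congr_ae ?_
      filter_upwards [huw] with x hx
      rw [hx]
      rcases lt_or_ge (w x) 0 with hlt | hge
      · have : v x = -w x := max_eq_left (by linarith)
        rw [this, neg_neg]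
        ring
      · have : v x = 0 := max_eq_right (by linarith)
        rw [this]
        ring
    have h4 : ∫ x in Ω, (lam * (v x * v x) + ∑ i, a i * v x ^ (p i + 1)) =
        lam * S + ∑ i, a i * ∫ x in Ω, v x ^ (p i + 1) := by
      rw [integral_add (hvv.const_mul _) (integrable_finsetSum _ fun i _ => (hpow i).const_mul _),
        integral_const_mul, integral_finsetSum _ fun i _ => (hpow i).const_mul _]
      simp_rw [integral_const_mul]
      rfl
    rw [h1, ← h4]
    obtain ⟨B, hB⟩ := (isCompact_Icc (a := -|K|) (b := |K|)).exists_bound_of_continuousOn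
      hfc.continuousOn
    refine integral_mono_ae ?_ ((hvv.const_mul _).add
      (integrable_finsetSum _ fun i _ => (hpow i).const_mul _))
      (Eventually.of_forall fun x => ?_)
    · refine (hvΩ.memLp_fun.integrable one_le_two).bdd_mul (c := B)
        (hfc.comp_aestronglyMeasurable hvm.neg).neg ?_
      filter_upwards [hvK] with x hx
      rw [norm_neg]
      exact hB _ ⟨neg_le_neg hx, (neg_nonpos.2 (hv0 x)).trans (abs_nonneg _)⟩
    · have h5 := mul_le_mul_of_nonneg_right (hf_bound (v x) (hv0 x)) (hv0 x)
      refine h5.trans (le_of_eq ?_)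
      rw [add_mul, Finset.sum_mul, mul_assoc]
      congr 1
      refine Finset.sum_congr rfl fun i _ => ?_
      have hp1 := (hp i).1
      rw [Real.rpow_add_one' (hv0 x) (by linarith), mul_assoc]
  -- the superlinear terms
  have hT : ∀ i, ∫ x in Ω, v x ^ (p i + 1) ≤ C i ^ 2 *
      ((eLpNorm (fun x => max (-uhat x) 0) (ENNReal.ofReal (p i + 1))
        (volume.restrict Ω)).toReal + C i * ρ) ^ (p i - 1) * D := by
    intro i
    have hp1 := (hp i).1
    refine integral_rpow_le_of_isEmbeddingBound hp1 (hC i) hvΩ hv0 ?_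
    have hq : (1 : ℝ≥0∞) ≤ ENNReal.ofReal (p i + 1) := by
      rw [← ENNReal.ofReal_one]
      exact ENNReal.ofReal_le_ofReal (by linarith)
    have hum : AEStronglyMeasurable (fun x => max (-uhat x) 0) (volume.restrict Ω) :=
      (by fun_prop : Continuous fun t : ℝ => max (-t) 0).comp_aestronglyMeasurable
        huhat.memLp_fun.1
    have hun : MemLp (fun x => max (-uhat x) 0) (ENNReal.ofReal (p i + 1))
        (volume.restrict Ω) := by
      refine (huhat_bdd.mono_exponent le_top).mono hum (Eventually.of_forall fun x => ?_)
      rw [Real.norm_of_nonneg (le_max_right _ _)]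
      exact max_le (neg_le_abs _) (abs_nonneg _)
    -- The embedding is applied to `w - û`, whose gradient norm is at most `ρ`.
    have hdiff := ((hC i).2 _ _ (hwH.sub huhat)).trans (mul_le_mul_right hH10 _)
    rw [← ENNReal.ofReal_mul (hC i).1.le] at hdiff
    have h1 : eLpNorm v (ENNReal.ofReal (p i + 1)) (volume.restrict Ω) ≤
        eLpNorm (fun x => max (-uhat x) 0) (ENNReal.ofReal (p i + 1)) (volume.restrict Ω) +
          ENNReal.ofReal (C i * ρ) := by
      refine le_trans ?_ (add_le_add le_rfl hdiff)
      -- Pointwise `v ≤ û₋ + |w - û|`, followed by Minkowski's inequality.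
      refine le_trans (eLpNorm_mono_real fun x => ?_) ((eLpNorm_add_le hum
        (hwH.memLp_fun.1.sub huhat.memLp_fun.1).norm hq).trans
          (add_le_add le_rfl (eLpNorm_norm _).le))
      rw [Real.norm_of_nonneg (hv0 x)]
      change max (-w x) 0 ≤ max (-uhat x) 0 + ‖w x - uhat x‖
      refine max_le ?_ (add_nonneg (le_max_right _ _) (norm_nonneg _))
      have := neg_le_abs (w x - uhat x)
      rw [Real.norm_eq_abs]
      linarith [le_max_left (-uhat x) 0]
    have h2 := ENNReal.toReal_mono (ENNReal.add_ne_top.2 ⟨hun.2.ne, ENNReal.ofReal_ne_top⟩) h1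
    rwa [ENNReal.toReal_add hun.2.ne ENNReal.ofReal_ne_top,
      ENNReal.toReal_ofReal (mul_nonneg (hC i).1.le hρ.le)] at h2
  have hcond' : ∑ i, a i * C i ^ 2 *
      ((eLpNorm (fun x => max (-uhat x) 0) (ENNReal.ofReal (p i + 1))
        (volume.restrict Ω)).toReal + C i * ρ) ^ (p i - 1) < 1 - max lam 0 / l := by
    rw [← EReal.coe_div, ← EReal.coe_one, ← EReal.coe_sub, EReal.coe_lt_coe_iff] at hcond
    exact hcond
  refine false_of_energy_le (integral_nonneg fun x => real_inner_self_nonneg) hS0 hlS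
    (EReal.coe_lt_coe_iff.1 hlam) hcond' (hE.trans ?_)
  gcongr
  rw [Finset.sum_mul]
  refine Finset.sum_le_sum fun i _ => ?_
  calc a i * ∫ x in Ω, v x ^ (p i + 1) ≤ a i * (C i ^ 2 *
      ((eLpNorm (fun x => max (-uhat x) 0) (ENNReal.ofReal (p i + 1))
        (volume.restrict Ω)).toReal + C i * ρ) ^ (p i - 1) * D) :=
        mul_le_mul_of_nonneg_left (hT i) (ha i)
    _ = _ := by ring
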